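/- All graphs are finite directed multigraphs without loops; degrees count in- and out-edges with multiplicity, and a graph is $D$-bounded if all its degrees are at most $D$. A $k$-colored graph is a pair $(G,\chi)$ with $\chi : V(G)\to[k]$ a proper coloring (the endpoints of every edge get different colors). A doubly-rooted $k$-colored graph is a $k$-colored graph with a designated root edge $(u,v)$; isomorphisms preserve edge multiplicities, each color, and the directed root edge. Let $\mathcal{T}_{k,\ell,D}$ be the (finite) set of isomorphism classes of $D$-bounded doubly-rooted $k$-colored graphs in which every vertex is joined to $u$ or $v$ by a path of length at most $\ell$ (paths ignore edge directions). For an edge $e=(u,v)$ of a $D$-bounded $k$-colored graph $(G,\chi)$, its radius-$\ell$ neighborhood type is the class in $\mathcal{T}_{k,\ell,D}$ of the subgraph induced on the vertices within distance $\ell$ of $u$ or $v$, with the restricted coloring and with root $e$. If $G$ has at least one edge, let $\mathcal{E}_\ell(G,\chi)$ be the distribution on $\mathcal{T}_{k,\ell,D}$ of the radius-$\ell$ neighborhood type of a uniformly random edge of $G$ (counted with multiplicity). **Theorem.** For all $k,\ell,D\in\mathbb{N}$ and $\varepsilon,\delta>0$ there exist $C>0$ and a one-pass streaming algorithm $A$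 that, on graphs with vertex set $[n]$, $n\ge 2$, uses at most $C\log n$ bits of space, and such that the following holds for every $D$-bounded $k$-colored graph $(G,\chi)$ with vertex set $[n]$ and at least one edge. Given black-box access to $\chi$ and a single pass over the edges of $G$, $A$ always outputs a probability distribution $\mathcal{D}$ on $\mathcal{T}_{k,\ell,D}$, and if the order of the edges is uniformly random, then $$\Pr\Big[\tfrac12\sum_{T\in\mathcal{T}_{k,\ell,D}}\big|\mathcal{D}(T)-\mathcal{E}_\ell(G,\chi)(T)\big|\le\varepsilon\Big]\ \ge\ 1-\delta .$$ The algorithm may be taken deterministic, so that the probability is over the order of the edges only. (Algorithms are uniform: a fixed program, independent of $n$, with finitely many control states and finitely many registers holding natural numbers, initially $n$ in one register and $0$ in the others, which can increment, decrement, copy and compare registers, read the next edge of the stream, and query $\chi$; the space is the number of bits of the control state and of the register contents.) -/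

import Mathlib

universe u

/-! ### Directed multigraphs -/

/-- A loopless directed multigraph on the vertex type `V`; its multiset of edges is given by the
multiplicity function `mult`. -/
structure DiMultigraph (V : Type) where
  mult : V → V → ℕ
  loopless : ∀ v, mult v v = 0

namespace DiMultigraph

variable {V : Type}

/-- The total degree (in-degree plus out-degree) of a vertex, counted with multiplicity. -/
def degree [Fintype V] (G : DiMultigraph V) (v : V) : ℕ :=
  ∑ u, (G.mult u v + G.mult v u)

/-- The maximum degree is at most `D`. -/
def IsBounded [Fintype V] (G : DiMultigraph V) (D : ℕ) : Prop :=
  ∀ v, G.degree v ≤ D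

/-- The number of edges, counted with multiplicity. -/
def numEdges [Fintype V] (G : DiMultigraph V) : ℕ :=
  ∑ e : V × V, G.mult e.1 e.2

/-- The set underlying the multiset of edges. -/
def Edge (G : DiMultigraph V) : Type :=
  {e : V × V // 0 < G.mult e.1 e.2}

/-- Adjacency with directions and multiplicities forgotten. -/
def toSimple (G : DiMultigraph V) : SimpleGraph V where
  Adj u v := 0 < G.mult u v ∨ 0 < G.mult v u
  symm := ⟨fun _ _ h => h.symm⟩
  loopless := ⟨fun v h => by simp [G.loopless] at h⟩

/-- A proper coloring: the endpoints of every edge get different colors. -/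
def IsProperColoring {k : ℕ} (G : DiMultigraph V) (χ : V → Fin k) : Prop :=
  ∀ u v, 0 < G.mult u v → χ u ≠ χ v

/-- The vertices joined to an endpoint of `e` by a path (ignoring directions) of length at
most `ℓ`. -/
def edgeBall (G : DiMultigraph V) (ℓ : ℕ) (e : V × V) : Set V :=
  {w | (∃ p : G.toSimple.Walk e.1 w, p.length ≤ ℓ) ∨
       (∃ p : G.toSimple.Walk e.2 w, p.length ≤ ℓ)}

/-- The induced subgraph on a set of vertices. -/
def induce (G : DiMultigraph V) (N : Set V) : DiMultigraph N where
  mult u v := G.mult u v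
  loopless v := G.loopless v

/-- The orderings of the multiset of edges: sequences in which every pair `e` occurs exactly as
often as its multiplicity. -/
def orderings [Fintype V] [DecidableEq V] (G : DiMultigraph V) :
    Finset (Fin G.numEdges → V × V) :=
  Finset.univ.filter fun σ => ∀ e : V × V,
    (Finset.univ.filter fun i => σ i = e).card = G.mult e.1 e.2

open Classical in
/-- The probability of the event `P` under a uniformly random ordering of the edges. -/
noncomputable def orderingProb [Fintype V] [DecidableEq V] (G : DiMultigraph V)
    (P : (Fin G.numEdges → V × V) → Prop) : ℝ :=
  ((G.orderings.filter P).card : ℝ) / (G.orderings.card : ℝ)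

/-- Every graph has an ordering, so `orderingProb` is a genuine probability. -/
theorem orderings_nonempty [Fintype V] [DecidableEq V] (G : DiMultigraph V) :
    G.orderings.Nonempty := by
  have hcard : Fintype.card (Σ e : V × V, Fin (G.mult e.1 e.2)) = G.numEdges := by
    simp [numEdges]
  let f := (Fintype.equivFinOfCardEq hcard).symm
  refine ⟨fun i => (f i).1, ?_⟩
  simp only [orderings, Finset.mem_filter, Finset.mem_univ, true_and]
  intro e
  have h : (Finset.univ.filter fun i => (f i).1 = e).card =
      (Finset.univ.filter fun x : (Σ e : V × V, Fin (G.mult e.1 e.2)) => x.1 = e).card :=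
    Finset.card_bij (fun i _ => f i) (by simp) (fun _ _ _ _ h => f.injective h)
      (fun x hx => ⟨f.symm x, by simpa using hx, by simp⟩)
  have h' : (Finset.univ.filter fun x : (Σ e : V × V, Fin (G.mult e.1 e.2)) => x.1 = e) =
      Finset.univ.map ⟨fun j : Fin (G.mult e.1 e.2) => ⟨e, j⟩, fun _ _ h => by simpa using h⟩ := by
    ext ⟨e', j⟩
    simp only [Finset.mem_filter, Finset.mem_univ, true_and, Finset.mem_map,
      Function.Embedding.coeFn_mk]
    constructor
    · rintro rfl
      exact ⟨j, rfl⟩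
    · rintro ⟨j', h⟩
      exact (congrArg Sigma.fst h).symm
  rw [h, h', Finset.card_map, Finset.card_univ, Fintype.card_fin]

theorem mem_edgeBall_left (G : DiMultigraph V) (ℓ : ℕ) (e : V × V) : e.1 ∈ G.edgeBall ℓ e :=
  Or.inl ⟨.nil, by simp⟩

theorem mem_edgeBall_right (G : DiMultigraph V) (ℓ : ℕ) (e : V × V) : e.2 ∈ G.edgeBall ℓ e :=
  Or.inr ⟨.nil, by simp⟩

/-- A path that stays within the ball around `e` is a path of the induced subgraph. -/
theorem exists_walk_induce (G : DiMultigraph V) (N : Set V) {u w : V} (p : G.toSimple.Walk u w)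
    (hp : ∀ x ∈ p.support, x ∈ N) (hu : u ∈ N) (hw : w ∈ N) :
    ∃ q : (G.induce N).toSimple.Walk ⟨u, hu⟩ ⟨w, hw⟩, q.length = p.length := by
  induction p with
  | nil => exact ⟨.nil, rfl⟩
  | @cons a b c h p ih =>
    have hb : b ∈ N := hp b (by simp)
    obtain ⟨q, hq⟩ := ih (fun x hx => hp x (by simp [hx])) hb hw
    have h' : (G.induce N).toSimple.Adj ⟨a, hu⟩ ⟨b, hb⟩ := h
    exact ⟨.cons h' q, by simp [hq]⟩

end DiMultigraph

/-! ### Doubly-rooted colored graphs and their isomorphism types -/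

/-- A finite properly `k`-colored graph with a designated root edge. -/
structure RootedColoredGraph (k : ℕ) where
  V : Type
  [fintypeV : Fintype V]
  graph : DiMultigraph V
  color : V → Fin k
  proper : graph.IsProperColoring color
  root : V × V
  root_mem : 0 < graph.mult root.1 root.2

attribute [instance] RootedColoredGraph.fintypeV

namespace RootedColoredGraph

variable {k : ℕ}

/-- Isomorphism preserves multiplicities, every single color, and the (directed) root edge. -/
def IsIsomorphic (X Y : RootedColoredGraph k) : Prop :=
  ∃ φ : X.V ≃ Y.V,
    (∀ u v, X.graph.mult u v = Y.graph.mult (φ u) (φ v)) ∧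
    (∀ v, X.color v = Y.color (φ v)) ∧
    (φ X.root.1, φ X.root.2) = Y.root

instance isoSetoid (k : ℕ) : Setoid (RootedColoredGraph k) where
  r := IsIsomorphic
  iseqv := by
    refine ⟨fun X => ⟨Equiv.refl _, by simp⟩, ?_, ?_⟩
    · rintro X Y ⟨φ, h₁, h₂, h₃⟩
      exact ⟨φ.symm, by simp [h₁], by simp [h₂], by simp [← h₃]⟩
    · rintro X Y Z ⟨φ, h₁, h₂, h₃⟩ ⟨ψ, g₁, g₂, g₃⟩
      exact ⟨φ.trans ψ, by simp [h₁, g₁], by simp [h₂, g₂], by simp [← g₃, ← h₃]⟩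

end RootedColoredGraph

/-- Isomorphism classes of doubly-rooted `k`-colored graphs. -/
def RootedType (k : ℕ) : Type 1 := Quotient (RootedColoredGraph.isoSetoid k)

/-- The isomorphism classes of the `D`-bounded doubly-rooted `k`-colored graphs in which every
vertex is at distance at most `ℓ` from one of the two roots. -/
def boundedTypes (k ℓ D : ℕ) : Set (RootedType k) :=
  {T | ∃ X : RootedColoredGraph k, Quotient.mk _ X = T ∧ X.graph.IsBounded D ∧
    ∀ w, w ∈ X.graph.edgeBall ℓ X.root}

namespace DiMultigraph

variable {V : Type} [Fintype V] {k : ℕ}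

open Classical in
/-- The subgraph induced on the radius-`ℓ` ball around the edge `e`, with the restricted coloring
and with root `e`. -/
noncomputable def edgeNbhd (G : DiMultigraph V) (χ : V → Fin k) (hχ : G.IsProperColoring χ)
    (ℓ : ℕ) (e : G.Edge) : RootedColoredGraph k where
  V := G.edgeBall ℓ e.1
  graph := G.induce (G.edgeBall ℓ e.1)
  color v := χ v
  proper u v h := hχ u v h
  root := (⟨e.1.1, G.mem_edgeBall_left ℓ e.1⟩, ⟨e.1.2, G.mem_edgeBall_right ℓ e.1⟩)
  root_mem := e.2

theorem edgeNbhd_mem (G : DiMultigraph V) (χ : V → Fin k) (hχ : G.IsProperColoring χ)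
    (ℓ D : ℕ) (hD : G.IsBounded D) (e : G.Edge) :
    (Quotient.mk _ (G.edgeNbhd χ hχ ℓ e) : RootedType k) ∈ boundedTypes k ℓ D := by
  classical
  refine ⟨_, rfl, ?_, ?_⟩
  · intro v
    refine le_trans ?_ (hD v.1)
    change ∑ u : G.edgeBall ℓ e.1, (G.mult u v.1 + G.mult v.1 u) ≤ _
    rw [← Finset.sum_image (s := Finset.univ) (g := fun u : G.edgeBall ℓ e.1 => (u : V))
      (f := fun u => G.mult u v.1 + G.mult v.1 u) (fun _ _ _ _ h => Subtype.ext h)]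
    exact Finset.sum_le_sum_of_subset (Finset.subset_univ _)
  · rintro ⟨w, hw⟩
    have key : ∀ {u : V}, (∀ x, (∃ p : G.toSimple.Walk u x, p.length ≤ ℓ) →
        x ∈ G.edgeBall ℓ e.1) → ∀ hu : u ∈ G.edgeBall ℓ e.1,
        (∃ p : G.toSimple.Walk u w, p.length ≤ ℓ) →
        ∃ q : (G.induce (G.edgeBall ℓ e.1)).toSimple.Walk ⟨u, hu⟩ ⟨w, hw⟩, q.length ≤ ℓ := by
      rintro u hx hu ⟨p, hp⟩
      obtain ⟨q, hq⟩ := G.exists_walk_induce (G.edgeBall ℓ e.1) p (fun x hxs =>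
        hx x ⟨p.takeUntil x hxs, (p.length_takeUntil_le_length hxs).trans hp⟩) hu hw
      exact ⟨q, hq.le.trans hp⟩
    rcases hw with h | h
    · exact Or.inl (key (fun x hx => Or.inl hx) _ h)
    · exact Or.inr (key (fun x hx => Or.inr hx) _ h)

/-- The radius-`ℓ` neighborhood type of an edge of a `D`-bounded properly colored graph. -/
noncomputable def nbrType (G : DiMultigraph V) (χ : V → Fin k) (hχ : G.IsProperColoring χ)
    (ℓ D : ℕ) (hD : G.IsBounded D) (e : G.Edge) : boundedTypes k ℓ D :=
  ⟨Quotient.mk _ (G.edgeNbhd χ hχ ℓ e), G.edgeNbhd_mem χ hχ ℓ D hD e⟩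

theorem tsum_mult_ne_zero (G : DiMultigraph V) (hG : G.numEdges ≠ 0) :
    ∑' e : G.Edge, (G.mult e.1.1 e.1.2 : ENNReal) ≠ 0 := by
  obtain ⟨e, -, he⟩ := Finset.exists_ne_zero_of_sum_ne_zero hG
  intro h
  have := ENNReal.tsum_eq_zero.1 h ⟨e, Nat.pos_of_ne_zero he⟩
  exact he (by exact_mod_cast this)

theorem tsum_mult_ne_top (G : DiMultigraph V) :
    ∑' e : G.Edge, (G.mult e.1.1 e.1.2 : ENNReal) ≠ ⊤ := by
  classical
  have : Fintype G.Edge := by unfold Edge; infer_instance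
  rw [tsum_fintype]
  exact ENNReal.sum_ne_top.2 fun e _ => ENNReal.natCast_ne_top _

/-- The uniform distribution on the multiset of edges: an edge has probability its multiplicity
divided by the total number of edges. -/
noncomputable def uniformEdge (G : DiMultigraph V) (hG : G.numEdges ≠ 0) : PMF G.Edge :=
  PMF.normalize (fun e : G.Edge => (G.mult e.1.1 e.1.2 : ENNReal))
    (G.tsum_mult_ne_zero hG) G.tsum_mult_ne_top

/-- The radius-`ℓ` edge neighborhood-type distribution: the type of a uniformly random edge. -/
noncomputable def edgeDist (G : DiMultigraph V) (χ : V → Fin k) (hχ : G.IsProperColoring χ)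
    (ℓ D : ℕ) (hD : G.IsBounded D) (hG : G.numEdges ≠ 0) : PMF (boundedTypes k ℓ D) :=
  (G.uniformEdge hG).map (G.nbrType χ hχ ℓ D hD)

end DiMultigraph

/-- Total variation distance of two discrete distributions. -/
noncomputable def tvDist {S : Type u} (p q : PMF S) : ℝ :=
  (1 / 2) * ∑' s, |(p s).toReal - (q s).toReal|

/-! ### One-pass streaming algorithms

A uniform machine model: a fixed finite program (independent of the number `n` of vertices) that
works on a fixed finite set of registers holding natural numbers. It can count up and down, copy
and compare registers, read the next edge of the stream, and query the coloring oracle. The space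
of a configuration is the number of bits of its memory (logarithmic cost); up to constant factors
this is the space of a Turing machine with a one-way read-only input. -/

/-- The instructions. -/
inductive StreamInstr (Q R : Type) (k : ℕ) (Out : Type u) : Type u
  /-- stop and output `out` -/
  | halt (out : Out)
  /-- add one to a register -/
  | inc (r : R) (next : Q)
  /-- subtract one from a register (zero stays zero) -/
  | dec (r : R) (next : Q)
  /-- copy one register to another -/
  | copy (src dst : R) (next : Q)
  /-- three-way branch on the comparison of two registers -/
  | compare (r s : R) (next : Ordering → Q)
  /-- read the next edge of the stream, if there is one, into two registers -/
  | readEdge (r s : R) (next eof : Q)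
  /-- branch on the color of the vertex in a register (`none` if it holds no vertex) -/
  | queryColor (r : R) (next : Option (Fin k) → Q)

/-- A one-pass streaming algorithm with oracle access to a `k`-coloring and outputs in `Out`. -/
structure StreamAlg (k : ℕ) (Out : Type u) where
  /-- control states -/
  Q : Type
  /-- registers -/
  R : Type
  [fintypeQ : Fintype Q]
  [fintypeR : Fintype R]
  [decEqR : DecidableEq R]
  /-- the program -/
  instr : Q → StreamInstr Q R k Out
  /-- initial control state -/
  start : Q
  /-- the register that initially holds the number of vertices; all others hold zero -/
  inputReg : R

attribute [instance] StreamAlg.fintypeQ StreamAlg.fintypeR StreamAlg.decEqR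

namespace StreamAlg

variable {k : ℕ} {Out : Type u}

/-- A configuration: control state, contents of the registers, and the unread part of the
stream. -/
structure Config (A : StreamAlg k Out) (n : ℕ) where
  state : A.Q
  regs : A.R → ℕ
  rest : List (Fin n × Fin n)

/-- The initial configuration on a given stream. -/
def init (A : StreamAlg k Out) {n : ℕ} (stream : List (Fin n × Fin n)) : A.Config n where
  state := A.start
  regs := Function.update (fun _ => 0) A.inputReg n
  rest := stream

/-- One step of the computation, with coloring oracle `χ`. A halted machine stays put. -/
def step (A : StreamAlg k Out) {n : ℕ} (χ : Fin n → Fin k) (c : A.Config n) : A.Config n :=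
  match A.instr c.state with
  | .halt _ => c
  | .inc r q => ⟨q, Function.update c.regs r (c.regs r + 1), c.rest⟩
  | .dec r q => ⟨q, Function.update c.regs r (c.regs r - 1), c.rest⟩
  | .copy r s q => ⟨q, Function.update c.regs s (c.regs r), c.rest⟩
  | .compare r s q => ⟨q (Ord.compare (c.regs r) (c.regs s)), c.regs, c.rest⟩
  | .readEdge r s q eof =>
    match c.rest with
    | [] => ⟨eof, c.regs, []⟩
    | e :: es => ⟨q, Function.update (Function.update c.regs r e.1) s e.2, es⟩
  | .queryColor r q =>
    ⟨q (if h : c.regs r < n then some (χ ⟨c.regs r, h⟩) else none), c.regs, c.rest⟩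

/-- The configuration after `t` steps. -/
def run (A : StreamAlg k Out) {n : ℕ} (χ : Fin n → Fin k) (stream : List (Fin n × Fin n))
    (t : ℕ) : A.Config n :=
  (A.step χ)^[t] (A.init stream)

/-- The algorithm halts on the stream, with the given output. -/
def Outputs (A : StreamAlg k Out) {n : ℕ} (χ : Fin n → Fin k) (stream : List (Fin n × Fin n))
    (out : Out) : Prop :=
  ∃ t, A.instr (A.run χ stream t).state = .halt out

/-- The number of bits of memory of a configuration: the control state and the binary
expansions of the registers. -/
def Config.bits {A : StreamAlg k Out} {n : ℕ} (c : A.Config n) : ℕ :=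
  Nat.clog 2 (Fintype.card A.Q) + ∑ r, Nat.size (c.regs r)

/-- On inputs with `n` vertices the algorithm never uses more than `s` bits of memory, whatever
the coloring oracle and the stream are. -/
def UsesSpaceAtMost (A : StreamAlg k Out) (n : ℕ) (s : ℝ) : Prop :=
  ∀ (χ : Fin n → Fin k) (stream : List (Fin n × Fin n)) (t : ℕ),
    ((A.run χ stream t).bits : ℝ) ≤ s

end StreamAlg

/-! ### Balls around edges, neighborhood types, and their locality -/

namespace DiMultigraph

variable {V V' : Type} {k : ℕ}

/-! The algorithm keeps the first `s` edges of the stream as roots, and afterwards every edge that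
touches the ball around some root in the graph of the edges kept so far. An edge that arrives before
the path joining it to its root is lost, so the graph seen around a root can be a proper, biased
part of its true neighborhood. The proof corrects this bias exactly and then averages over the
roots.

Fix a root `e` and let `f S` be the indicator that `e` has type `T` in the graph with edges `e` and
`S`. By Möbius inversion (`sum_powerset_altSum`), the value of `f` at the set of all other edges is
the sum over all subsets `H` of the alternating sum of `f` over the subsets of `H`. Call an ordering
of `H` collectable if each edge touches the ball formed by `e` and the edges before it. If the
stream lists `H` in a collectable order, count the alternating sum of `H` divided by the fraction of
orderings of `H` that are collectable; otherwise count 0. In a uniformly random order this has the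
right expectation (`sum_permutations_weight`). The only problem would be a set with no collectable
ordering, but its alternating sum is 0, because an edge that cannot be reached does not affect the
type (`altSum_eq_zero_of_not_collectable`). Summing over `H` gives an unbiased estimate, and it can
be computed from the kept edges, since every collectable subsequence of the stream consists of kept
edges (`sum_sublists_collect`).

Only sets `H` of edges touching the true ball contribute. There are boundedly many such edges, so
the estimate is bounded in terms of `ℓ` and `D`. Estimates at two roots with disjoint neighborhoods
depend on the orders of disjoint sets and factorize; pairs with overlapping neighborhoods are a
fraction O(1/m) of all pairs among m edges. Hence the average over `s` roots has variance O(1/s)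
(`LocalStatistic.second_moment_le`). Chebyshev's inequality and a union bound over the finitely many
types finish the probabilistic part, with constant `s`. A graph with fewer than `s` edges is stored
entirely and its distribution is computed exactly.

For the space bound, the kept edges number at most a constant. Whether to keep an edge, and what to
output, depends only on which stored endpoints coincide and on their colors. That is a bounded
amount of information and fits in the control state, so the registers hold nothing but vertex names
(`collector`). -/

theorem exists_walk_length_le_succ {G : SimpleGraph V} {u w : V} {ℓ : ℕ} :
    (∃ p : G.Walk u w, p.length ≤ ℓ + 1) ↔
      (∃ p : G.Walk u w, p.length ≤ ℓ) ∨ ∃ v, (∃ p : G.Walk u v, p.length ≤ ℓ) ∧ G.Adj v w := by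
  constructor
  · rintro ⟨p, hp⟩
    cases p with
    | nil => exact Or.inl ⟨.nil, by simp⟩
    | cons h p =>
      obtain ⟨x, q, h', hq⟩ := SimpleGraph.Walk.exists_cons_eq_concat h p
      rw [hq, SimpleGraph.Walk.length_concat] at hp
      exact Or.inr ⟨x, ⟨q, by omega⟩, h'⟩
  · rintro (⟨p, hp⟩ | ⟨v, ⟨p, hp⟩, h⟩)
    · exact ⟨p, by omega⟩
    · exact ⟨p.concat h, by simpa using hp⟩

theorem edgeBall_zero (G : DiMultigraph V) (e : V × V) : G.edgeBall 0 e = {e.1, e.2} := by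
  ext w
  simp only [edgeBall, Set.mem_ofPred_eq, Set.mem_insert_iff, Set.mem_singleton_iff]
  have key : ∀ u, (∃ p : G.toSimple.Walk u w, p.length ≤ 0) ↔ w = u := by
    intro u
    constructor
    · rintro ⟨p, hp⟩
      exact (SimpleGraph.Walk.eq_of_length_eq_zero (Nat.le_zero.1 hp)).symm
    · rintro rfl
      exact ⟨.nil, by simp⟩
  rw [key, key]

theorem mem_edgeBall_succ (G : DiMultigraph V) (ℓ : ℕ) (e : V × V) (w : V) :
    w ∈ G.edgeBall (ℓ + 1) e ↔
      w ∈ G.edgeBall ℓ e ∨ ∃ v ∈ G.edgeBall ℓ e, G.toSimple.Adj v w := by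
  simp only [edgeBall, Set.mem_ofPred_eq, exists_walk_length_le_succ]
  constructor
  · rintro ((h | ⟨v, h, a⟩) | (h | ⟨v, h, a⟩))
    · exact Or.inl (Or.inl h)
    · exact Or.inr ⟨v, Or.inl h, a⟩
    · exact Or.inl (Or.inr h)
    · exact Or.inr ⟨v, Or.inr h, a⟩
  · rintro ((h | h) | ⟨v, h | h, a⟩)
    · exact Or.inl (Or.inl h)
    · exact Or.inr (Or.inl h)
    · exact Or.inl (Or.inr ⟨v, h, a⟩)
    · exact Or.inr (Or.inr ⟨v, h, a⟩)

theorem edgeBall_mono_radius (G : DiMultigraph V) (e : V × V) :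
    Monotone fun ℓ => G.edgeBall ℓ e :=
  monotone_nat_of_le_succ fun ℓ _ hw => (G.mem_edgeBall_succ ℓ e _).2 (Or.inl hw)

/-- If every edge of `G'` that leaves the ball of `G` is an edge of `G`, then the ball of `G'` is
contained in the ball of `G`. -/
theorem edgeBall_subset_of_adj {G G' : DiMultigraph V} {ℓ : ℕ} {e : V × V}
    (h : ∀ v ∈ G.edgeBall ℓ e, ∀ w, G'.toSimple.Adj v w → G.toSimple.Adj v w) :
    G'.edgeBall ℓ e ⊆ G.edgeBall ℓ e := by
  have key : ∀ i ≤ ℓ, G'.edgeBall i e ⊆ G.edgeBall i e := by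
    intro i
    induction i with
    | zero => intro _; rw [edgeBall_zero, edgeBall_zero]
    | succ i ih =>
      intro hi w hw
      have ih := ih (by omega)
      rw [mem_edgeBall_succ] at hw ⊢
      rcases hw with hw | ⟨v, hv, a⟩
      · exact Or.inl (ih hw)
      · exact Or.inr ⟨v, ih hv,
          h v (G.edgeBall_mono_radius e (show i ≤ ℓ by omega) (ih hv)) w a⟩
  exact key ℓ le_rfl

theorem edgeBall_mono {G G' : DiMultigraph V} (h : G'.toSimple ≤ G.toSimple) (ℓ : ℕ)
    (e : V × V) : G'.edgeBall ℓ e ⊆ G.edgeBall ℓ e :=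
  edgeBall_subset_of_adj fun _ _ _ a => h a

/-- Being within distance `ℓ` of each other is a symmetric relation on edges. -/
theorem touches_edgeBall_symm (G : DiMultigraph V) (ℓ : ℕ) {e x : V × V}
    (h : x.1 ∈ G.edgeBall ℓ e ∨ x.2 ∈ G.edgeBall ℓ e) :
    e.1 ∈ G.edgeBall ℓ x ∨ e.2 ∈ G.edgeBall ℓ x := by
  rcases h with (⟨p, hp⟩ | ⟨p, hp⟩) | (⟨p, hp⟩ | ⟨p, hp⟩)
  · exact Or.inl (Or.inl ⟨p.reverse, by simpa using hp⟩)
  · exact Or.inr (Or.inl ⟨p.reverse, by simpa using hp⟩)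
  · exact Or.inl (Or.inr ⟨p.reverse, by simpa using hp⟩)
  · exact Or.inr (Or.inr ⟨p.reverse, by simpa using hp⟩)

/-- `T` is the type of the radius-`ℓ` neighborhood of `e` in `G`, colored by `χ`. -/
def HasType (G : DiMultigraph V) (χ : V → Fin k) (ℓ : ℕ) (e : V × V) (T : RootedType k) : Prop :=
  ∃ X : RootedColoredGraph k, Quotient.mk _ X = T ∧ ∃ φ : X.V → V, Function.Injective φ ∧
    Set.range φ = G.edgeBall ℓ e ∧ (∀ u v, X.graph.mult u v = G.mult (φ u) (φ v)) ∧
    (∀ v, X.color v = χ (φ v)) ∧ (φ X.root.1, φ X.root.2) = e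

/-- `HasType` describes a type by an embedded representative. Unlike `nbrType` it also makes sense
for a graph formed by part of the stream, with no proof of proper coloring or bounded degree
attached. -/
theorem nbrType_eq_iff_hasType [Fintype V] (G : DiMultigraph V) (χ : V → Fin k)
    (hχ : G.IsProperColoring χ) (ℓ D : ℕ) (hD : G.IsBounded D) (e : G.Edge)
    (T : boundedTypes k ℓ D) :
    G.nbrType χ hχ ℓ D hD e = T ↔ G.HasType χ ℓ e.1 T.1 := by
  rw [Subtype.ext_iff]
  constructor
  · intro h
    exact ⟨_, h, Subtype.val, Subtype.val_injective, Subtype.range_val, fun _ _ => rfl,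
      fun _ => rfl, rfl⟩
  · rintro ⟨X, hX, φ, hφ, hr, hm, hc, he⟩
    rw [← hX]
    refine (Quotient.sound (s := RootedColoredGraph.isoSetoid k) ?_).symm
    refine ⟨(Equiv.ofInjective φ hφ).trans (Equiv.setCongr hr), fun u v => hm u v, fun v => hc v,
      ?_⟩
    have h1 := congrArg Prod.fst he
    have h2 := congrArg Prod.snd he
    exact Prod.ext (Subtype.ext h1) (Subtype.ext h2)

theorem HasType.congr {G G' : DiMultigraph V} {χ : V → Fin k} {ℓ : ℕ} {e : V × V}
    {T : RootedType k} (hb : G.edgeBall ℓ e = G'.edgeBall ℓ e)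
    (hm : ∀ u ∈ G.edgeBall ℓ e, ∀ v, G.mult u v = G'.mult u v) (h : G.HasType χ ℓ e T) :
    G'.HasType χ ℓ e T := by
  obtain ⟨X, hX, φ, hφ, hr, hm', hc, he⟩ := h
  exact ⟨X, hX, φ, hφ, hr.trans hb,
    fun u v => (hm' u v).trans (hm _ (hr ▸ Set.mem_range_self u) _), hc, he⟩

section Map

variable {G : DiMultigraph V} {G' : DiMultigraph V'} {ψ : V → V'}

/-- The ball of an edge under an injective map that preserves multiplicities and whose image
contains all edges. -/
theorem edgeBall_map (hm : ∀ u v, G'.mult (ψ u) (ψ v) = G.mult u v)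
    (hr : ∀ u' v', G'.toSimple.Adj u' v' → v' ∈ Set.range ψ) (ℓ : ℕ)
    (e : V × V) : G'.edgeBall ℓ (Prod.map ψ ψ e) = ψ '' G.edgeBall ℓ e := by
  have hadj : ∀ u v, G'.toSimple.Adj (ψ u) (ψ v) ↔ G.toSimple.Adj u v := by
    intro u v
    simp only [toSimple, hm]
  induction ℓ with
  | zero => simp [edgeBall_zero, Set.image_pair]
  | succ ℓ ih =>
    ext w
    rw [mem_edgeBall_succ, ih]
    constructor
    · rintro (⟨v, hv, rfl⟩ | ⟨_, ⟨v, hv, rfl⟩, a⟩)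
      · exact ⟨v, (G.mem_edgeBall_succ ℓ e v).2 (Or.inl hv), rfl⟩
      · obtain ⟨w, rfl⟩ := hr _ _ a
        exact ⟨w, (G.mem_edgeBall_succ ℓ e w).2 (Or.inr ⟨v, hv, (hadj _ _).1 a⟩), rfl⟩
    · rintro ⟨w, hw, rfl⟩
      rcases (G.mem_edgeBall_succ ℓ e w).1 hw with hw | ⟨v, hv, a⟩
      · exact Or.inl ⟨w, hw, rfl⟩
      · exact Or.inr ⟨_, ⟨v, hv, rfl⟩, (hadj _ _).2 a⟩

/-- Vertices outside the image of `ψ` are isolated, so neither the ball nor the type sees them. This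
makes the decisions of the algorithm independent of vertex names. -/
theorem hasType_map (hψ : Function.Injective ψ)
    (hm : ∀ u v, G'.mult (ψ u) (ψ v) = G.mult u v)
    (hr : ∀ u' v', G'.toSimple.Adj u' v' → v' ∈ Set.range ψ) {χ : V → Fin k} {χ' : V' → Fin k}
    (hχ : ∀ v, χ' (ψ v) = χ v) (ℓ : ℕ) (e : V × V) (T : RootedType k) :
    G'.HasType χ' ℓ (Prod.map ψ ψ e) T ↔ G.HasType χ ℓ e T := by
  constructor
  · rintro ⟨X, hX, φ, hφ, hrφ, hm', hc, he⟩
    rw [edgeBall_map hm hr] at hrφ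
    have hex : ∀ x, ∃ v, ψ v = φ x := fun x => by
      have : φ x ∈ ψ '' G.edgeBall ℓ e := hrφ ▸ Set.mem_range_self x
      obtain ⟨v, -, hv⟩ := this
      exact ⟨v, hv⟩
    choose θ hθ using hex
    refine ⟨X, hX, θ, fun x y h => hφ (by rw [← hθ, ← hθ, h]), ?_, ?_, ?_, ?_⟩
    · have : ψ '' Set.range θ = ψ '' G.edgeBall ℓ e := by
        rw [← hrφ, ← Set.range_comp]
        congr 1
        exact funext hθ
      exact (Set.image_injective.2 hψ) this
    · intro u v
      rw [hm', ← hθ, ← hθ, hm]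
    · intro v
      rw [hc, ← hθ, hχ]
    · have h1 := congrArg Prod.fst he
      have h2 := congrArg Prod.snd he
      simp only [Prod.map_fst, Prod.map_snd, ← hθ] at h1 h2
      exact Prod.ext (hψ h1) (hψ h2)
  · rintro ⟨X, hX, φ, hφ, hrφ, hm', hc, he⟩
    refine ⟨X, hX, ψ ∘ φ, hψ.comp hφ, ?_, ?_, ?_, ?_⟩
    · rw [Set.range_comp, hrφ, edgeBall_map hm hr]
    · intro u v
      rw [hm', Function.comp, Function.comp, hm]
    · intro v
      rw [hc, Function.comp, hχ]
    · rw [← he]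
      rfl

end Map

open Classical in
/-- The graph with a given multiset of edges; loops are dropped. -/
noncomputable def ofEdges (S : Multiset (V × V)) : DiMultigraph V where
  mult u v := if u = v then 0 else S.count (u, v)
  loopless v := by simp

theorem ofEdges_adj {S : Multiset (V × V)} {u v : V} :
    (ofEdges S).toSimple.Adj u v ↔ u ≠ v ∧ ((u, v) ∈ S ∨ (v, u) ∈ S) := by
  classical
  by_cases h : u = v
  · simp [toSimple, ofEdges, h]
  · simp [toSimple, ofEdges, h, Ne.symm h, Multiset.count_pos]

theorem ofEdges_mono {S S' : Multiset (V × V)} (h : ∀ x ∈ S, x ∈ S') :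
    (ofEdges S).toSimple ≤ (ofEdges S').toSimple := by
  intro u v
  rw [ofEdges_adj, ofEdges_adj]
  exact fun ⟨hne, a⟩ => ⟨hne, a.imp (h _) (h _)⟩

theorem ofEdges_map_mult {ψ : V → V'} (hψ : Function.Injective ψ) (S : Multiset (V × V))
    (u v : V) : (ofEdges (S.map (Prod.map ψ ψ))).mult (ψ u) (ψ v) = (ofEdges S).mult u v := by
  classical
  have h := Multiset.count_map_eq_count' (Prod.map ψ ψ) S (hψ.prodMap hψ) (u, v)
  simp only [Prod.map_apply] at h
  simp only [ofEdges, hψ.eq_iff]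
  split_ifs
  · rfl
  · convert h

theorem ofEdges_map_range {ψ : V → V'} (S : Multiset (V × V)) (u' v' : V')
    (h : (ofEdges (S.map (Prod.map ψ ψ))).toSimple.Adj u' v') : v' ∈ Set.range ψ := by
  rw [ofEdges_adj] at h
  rcases h.2 with h | h <;> obtain ⟨x, -, hx⟩ := Multiset.mem_map.1 h
  · exact ⟨x.2, congrArg Prod.snd hx⟩
  · exact ⟨x.1, congrArg Prod.fst hx⟩

/-- The edge `x` has an endpoint in the radius-`ℓ` ball around `e` in the graph with edges `e`
and `S`. -/
def Touches (ℓ : ℕ) (e : V × V) (S : Multiset (V × V)) (x : V × V) : Prop :=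
  x.1 ∈ (ofEdges (e ::ₘ S)).edgeBall ℓ e ∨ x.2 ∈ (ofEdges (e ::ₘ S)).edgeBall ℓ e

open Classical in
/-- The indicator of the event that `e` has type `T` in the graph with edges `e` and `S`. -/
noncomputable def typeInd (χ : V → Fin k) (ℓ : ℕ) (T : RootedType k) (e : V × V)
    (S : Multiset (V × V)) : ℝ :=
  if (ofEdges (e ::ₘ S)).HasType χ ℓ e T then 1 else 0

theorem Touches.mono {ℓ : ℕ} {e x : V × V} {S S' : Multiset (V × V)} (hS : ∀ y ∈ S, y ∈ S')
    (h : Touches ℓ e S x) : Touches ℓ e S' x := by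
  have hm : (ofEdges (e ::ₘ S)).edgeBall ℓ e ⊆ (ofEdges (e ::ₘ S')).edgeBall ℓ e := by
    refine edgeBall_mono (ofEdges_mono fun y hy => ?_) ℓ e
    rw [Multiset.mem_cons] at hy ⊢
    exact hy.imp_right (hS y)
  exact h.imp (fun h => hm h) (fun h => hm h)

/-- Edges that do not touch the ball do not enlarge it. -/
theorem edgeBall_subset_of_not_touches {ℓ : ℕ} {e : V × V} {C S : Multiset (V × V)}
    (h : ∀ y ∈ S, y ∈ C ∨ ¬ Touches ℓ e C y) :
    (ofEdges (e ::ₘ S)).edgeBall ℓ e ⊆ (ofEdges (e ::ₘ C)).edgeBall ℓ e := by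
  refine edgeBall_subset_of_adj fun v hv w a => ?_
  rw [ofEdges_adj] at a ⊢
  refine ⟨a.1, a.2.imp (fun a => ?_) (fun a => ?_)⟩ <;> rw [Multiset.mem_cons] at a ⊢
  · exact a.imp_right fun a => (h _ a).resolve_right fun h => h (Or.inl hv)
  · exact a.imp_right fun a => (h _ a).resolve_right fun h => h (Or.inr hv)

/-- An edge without endpoints in the ball neither enlarges the ball nor changes a multiplicity
inside it. This locality is what makes the alternating sums of unreachable edge sets vanish. -/
theorem typeInd_cons_of_not_touches {χ : V → Fin k} {ℓ : ℕ} {T : RootedType k} {e x : V × V}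
    {S : Multiset (V × V)} (h : ¬ Touches ℓ e S x) :
    typeInd χ ℓ T e (x ::ₘ S) = typeInd χ ℓ T e S := by
  classical
  have hb : (ofEdges (e ::ₘ x ::ₘ S)).edgeBall ℓ e = (ofEdges (e ::ₘ S)).edgeBall ℓ e := by
    refine Set.Subset.antisymm (edgeBall_subset_of_not_touches fun y hy => ?_)
      (edgeBall_mono (ofEdges_mono fun y hy => ?_) ℓ e)
    · rcases Multiset.mem_cons.1 hy with rfl | hy
      · exact Or.inr h
      · exact Or.inl hy
    · rw [Multiset.mem_cons] at hy ⊢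
      exact hy.imp_right fun hy => Multiset.mem_cons_of_mem hy
  have hm : ∀ u ∈ (ofEdges (e ::ₘ S)).edgeBall ℓ e, ∀ v,
      (ofEdges (e ::ₘ S)).mult u v = (ofEdges (e ::ₘ x ::ₘ S)).mult u v := by
    intro u hu v
    have hx : (u, v) ≠ x := by
      rintro rfl
      exact h (Or.inl hu)
    simp only [ofEdges]
    split_ifs
    · rfl
    · rw [Multiset.cons_swap, Multiset.count_cons_of_ne hx]
  have : (ofEdges (e ::ₘ x ::ₘ S)).HasType χ ℓ e T ↔ (ofEdges (e ::ₘ S)).HasType χ ℓ e T :=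
    ⟨HasType.congr hb fun u hu v => (hm u (hb ▸ hu) v).symm, HasType.congr hb.symm hm⟩
  simp only [typeInd, this]

theorem typeInd_map {ψ : V → V'} (hψ : Function.Injective ψ) {χ : V → Fin k}
    {χ' : V' → Fin k} (hχ : ∀ v, χ' (ψ v) = χ v) (ℓ : ℕ) (T : RootedType k) (e : V × V)
    (S : Multiset (V × V)) :
    typeInd χ' ℓ T (Prod.map ψ ψ e) (S.map (Prod.map ψ ψ)) = typeInd χ ℓ T e S := by
  have := hasType_map hψ (ofEdges_map_mult hψ (e ::ₘ S)) (ofEdges_map_range (e ::ₘ S)) hχ ℓ e T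
  rw [Multiset.map_cons] at this
  classical
  exact if_congr this rfl rfl

theorem touches_map {ψ : V → V'} (hψ : Function.Injective ψ) (ℓ : ℕ) (e : V × V)
    (S : Multiset (V × V)) (x : V × V) :
    Touches ℓ (Prod.map ψ ψ e) (S.map (Prod.map ψ ψ)) (Prod.map ψ ψ x) ↔ Touches ℓ e S x := by
  have := edgeBall_map (ofEdges_map_mult hψ (e ::ₘ S)) (ofEdges_map_range (e ::ₘ S)) ℓ e
  rw [Multiset.map_cons] at this
  simp only [Touches, this, Prod.map_fst, Prod.map_snd, hψ.mem_set_image]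

end DiMultigraph

/-! ### Alternating sums and reweighted collectable sequences -/

namespace StreamSampling

variable {α β : Type}

/-- The alternating sum of `f` over the subsets of a list. -/
def altSum : List α → (Multiset α → ℝ) → ℝ
  | [], f => f 0
  | x :: h, f => altSum h (fun S => f (x ::ₘ S)) - altSum h f

theorem altSum_perm {h h' : List α} (p : h.Perm h') (f : Multiset α → ℝ) :
    altSum h f = altSum h' f := by
  induction p generalizing f with
  | nil => rfl
  | cons x _ ih => simp only [altSum, ih]
  | swap x y l =>
    simp only [altSum]
    rw [show (fun S => f (y ::ₘ x ::ₘ S)) = fun S => f (x ::ₘ y ::ₘ S) from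
      funext fun S => by rw [Multiset.cons_swap]]
    ring
  | trans _ _ ih ih' => rw [ih, ih']

theorem altSum_congr (h : List α) {f f' : Multiset α → ℝ} (hf : ∀ S ≤ (h : Multiset α), f S = f' S) :
    altSum h f = altSum h f' := by
  induction h generalizing f f' with
  | nil => exact hf 0 le_rfl
  | cons x h ih =>
    simp only [altSum]
    rw [ih fun S hS => hf S (hS.trans (Multiset.le_cons_self _ x)),
      ih (f' := fun S => f' (x ::ₘ S)) fun S hS => hf _ ((Multiset.cons_le_cons_iff x).2 hS)]

theorem altSum_cons_eq_zero (x : α) (h : List α) {f : Multiset α → ℝ}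
    (hf : ∀ S ≤ (h : Multiset α), f (x ::ₘ S) = f S) : altSum (x :: h) f = 0 := by
  rw [altSum, altSum_congr h hf, sub_self]

theorem abs_altSum_le (h : List α) {f : Multiset α → ℝ} (hf : ∀ S, |f S| ≤ 1) :
    |altSum h f| ≤ 2 ^ h.length := by
  induction h generalizing f with
  | nil => simpa [altSum] using hf 0
  | cons x h ih =>
    calc |altSum (x :: h) f| ≤ |altSum h fun S => f (x ::ₘ S)| + |altSum h f| := abs_sub _ _
      _ ≤ 2 ^ h.length + 2 ^ h.length := add_le_add (ih fun S => hf _) (ih hf)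
      _ = 2 ^ (x :: h).length := by rw [List.length_cons]; ring

theorem altSum_map (φ : α → β) (h : List α) (f : Multiset β → ℝ) :
    altSum (h.map φ) f = altSum h fun S => f (S.map φ) := by
  induction h generalizing f with
  | nil => rfl
  | cons x h ih => simp only [List.map_cons, altSum, ih, Multiset.map_cons]

/-- Möbius inversion. -/
theorem sum_powerset_altSum {ι : Type} [DecidableEq ι] (ρ : ι → α) (U : Finset ι)
    (f : Multiset α → ℝ) :
    ∑ H ∈ U.powerset, altSum (H.toList.map ρ) f = f (U.val.map ρ) := by
  induction U using Finset.induction_on generalizing f with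
  | empty => simp [altSum]
  | insert a U ha ih =>
    rw [Finset.sum_powerset_insert ha, ih, Finset.insert_val_of_notMem ha, Multiset.map_cons,
      ← ih fun S => f (ρ a ::ₘ S)]
    rw [← ih f, ← Finset.sum_add_distrib]
    refine Finset.sum_congr rfl fun H hH => ?_
    have haH : a ∉ H := fun h => ha (Finset.mem_powerset.1 hH h)
    rw [altSum_perm ((Finset.toList_insert haH).map ρ), List.map_cons, altSum]
    ring

/-- Every element of the list is reached from the elements before it. -/
def Collectable (t : Multiset α → α → Prop) (h : List α) : Prop :=
  ∀ (p : List α) (x : α), (p ++ [x]) <+: h → t p x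

theorem collectable_nil (t : Multiset α → α → Prop) : Collectable t [] := by
  intro p x h
  simp at h

theorem collectable_concat {t : Multiset α → α → Prop} {h : List α} {x : α} :
    Collectable t (h ++ [x]) ↔ Collectable t h ∧ t h x := by
  constructor
  · exact fun H => ⟨fun p y hp => H p y (hp.trans (List.prefix_append _ _)), H h x List.prefix_rfl⟩
  · rintro ⟨H, hx⟩ p y hp
    rw [List.prefix_concat_iff] at hp
    rcases hp with hp | hp
    · obtain ⟨rfl, hxy⟩ := List.append_inj' hp rfl
      rw [List.singleton_inj.1 hxy]
      exact hx
    · exact H p y hp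

theorem collectable_map {t : Multiset α → α → Prop} {t' : Multiset β → β → Prop} {φ : α → β}
    (ht : ∀ S x, t' (S.map φ) (φ x) ↔ t S x) (h : List α) :
    Collectable t' (h.map φ) ↔ Collectable t h := by
  induction h using List.reverseRecOn with
  | nil => simp [collectable_nil]
  | append_singleton h x ih =>
    rw [List.map_append, List.map_singleton, collectable_concat, collectable_concat, ih,
      ← Multiset.map_coe, ht]

/-- `f` does not depend on elements that are not reached. -/
def IsLocal (t : Multiset α → α → Prop) (f : Multiset α → ℝ) : Prop :=
  ∀ (C S : Multiset α) (x : α), (∀ y ∈ S, y ∈ C ∨ ¬ t C y) → ¬ t C x → f (x ::ₘ S) = f S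

/-- Build a collectable ordering greedily. Since it cannot be completed, the process stops at some
collectable `C` from which no remaining element is reached. Adding any one of these then leaves `f`
unchanged on every subset of the others, and the alternating sum cancels in pairs. -/
theorem altSum_eq_zero_of_not_collectable {t : Multiset α → α → Prop} {f : Multiset α → ℝ}
    (hf : IsLocal t f) (h : List α) (hh : ∀ o : List α, o.Perm h → ¬ Collectable t o) :
    altSum h f = 0 := by
  classical
  have key : ∀ (n : ℕ) (C D : List α), D.length = n → Collectable t C →
      (∀ o : List α, o.Perm (C ++ D) → ¬ Collectable t o) → altSum (C ++ D) f = 0 := by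
    intro n
    induction n with
    | zero =>
      intro C D hD hC ho
      rw [List.length_eq_zero_iff.1 hD, List.append_nil] at ho
      exact absurd hC (ho C (List.Perm.refl _))
    | succ n ih =>
      intro C D hD hC ho
      -- `C` is the collectable part built so far and `D` the remainder. Either some element of `D`
      -- extends `C`, or the process is stuck.
      by_cases hx : ∃ x ∈ D, t C x
      · obtain ⟨x, hxD, hx⟩ := hx
        have hp : (C ++ [x] ++ D.erase x).Perm (C ++ D) := by
          rw [List.append_assoc]
          exact (List.perm_cons_erase hxD).symm.append_left C
        rw [← altSum_perm hp]
        refine ih _ _ ?_ (collectable_concat.2 ⟨hC, hx⟩) fun o h => ho o (h.trans hp)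
        rw [List.length_erase_of_mem hxD, hD]
        rfl
      · push Not at hx
        obtain ⟨x, D, rfl⟩ := List.exists_cons_of_length_eq_add_one hD
        rw [altSum_perm (List.perm_middle (a := x) (l₁ := C) (l₂ := D))]
        refine altSum_cons_eq_zero x _ fun S hS => ?_
        refine hf C S x (fun y hy => ?_) (hx x (by simp))
        have := Multiset.mem_of_le hS hy
        rw [Multiset.mem_coe, List.mem_append] at this
        exact this.imp (fun h => h) fun h => hx y (List.mem_cons_of_mem x h)
  exact key _ [] h rfl (collectable_nil t) hh

open Classical in
/-- The weight of an observed sequence: its alternating sum, divided by the probability that a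
random ordering of the sequence is collectable. -/
noncomputable def weight (t : Multiset α → α → Prop) (f : Multiset α → ℝ) (h : List α) : ℝ :=
  if Collectable t h then
    altSum h f * ((h.length.factorial : ℝ) / (h.permutations.countP fun o => Collectable t o : ℕ))
  else 0

theorem weight_of_not_collectable {t : Multiset α → α → Prop} {f : Multiset α → ℝ} {h : List α}
    (hh : ¬ Collectable t h) : weight t f h = 0 := if_neg hh

/-- The average of the weights of the orderings of a list is its alternating sum. -/
theorem sum_permutations_weight {t : Multiset α → α → Prop} {f : Multiset α → ℝ}
    (hf : IsLocal t f) (h : List α) :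
    (h.permutations.map (weight t f)).sum = (h.length.factorial : ℝ) * altSum h f := by
  classical
  set N := h.permutations.countP fun o => Collectable t o with hN
  have h1 : h.permutations.map (weight t f) = h.permutations.map fun o =>
      (if Collectable t o then 1 else 0) * (altSum h f * ((h.length.factorial : ℝ) / N)) := by
    refine List.map_congr_left fun o ho => ?_
    have hp : o.Perm h := List.mem_permutations.1 ho
    unfold weight
    rw [altSum_perm hp f, hp.length_eq, hp.permutations.countP_eq]
    split_ifs <;> simp [hN]
  have h2 : ∀ L : List (List α), (L.map fun o => if Collectable t o then (1 : ℝ) else 0).sum =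
      (L.countP fun o => Collectable t o : ℕ) := by
    intro L
    induction L with
    | nil => simp
    | cons a L ih =>
      rw [List.map_cons, List.sum_cons, ih, List.countP_cons]
      by_cases ha : Collectable t a <;> simp [ha, add_comm]
  rw [h1, List.sum_map_mul_right, h2, ← hN]
  -- If no ordering is collectable all weights are 0, and so is the alternating sum; otherwise the
  -- `N` collectable orderings cancel the denominator.
  by_cases h0 : N = 0
  · have : altSum h f = 0 := altSum_eq_zero_of_not_collectable hf h fun o ho hc => by
      rw [hN, List.countP_eq_zero] at h0
      exact h0 o (List.mem_permutations.2 ho) (by simpa using hc)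
    rw [this]
    simp
  · have : (N : ℝ) ≠ 0 := by exact_mod_cast h0
    field_simp

/-- The alternating sum has 2 ^ `h.length` terms of size at most 1. Where the weight is not 0, `h`
itself is a collectable ordering, so the denominator is at least 1. -/
theorem abs_weight_le (t : Multiset α → α → Prop) {f : Multiset α → ℝ} (hf : ∀ S, |f S| ≤ 1)
    (h : List α) : |weight t f h| ≤ 2 ^ h.length * h.length.factorial := by
  classical
  unfold weight
  split_ifs with hc
  · rw [abs_mul]
    refine mul_le_mul (abs_altSum_le h hf) ?_ (abs_nonneg _) (by positivity)
    have : (1 : ℝ) ≤ (h.permutations.countP fun o => Collectable t o : ℕ) := by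
      have : 0 < h.permutations.countP fun o => Collectable t o :=
        List.countP_pos_iff.2 ⟨h, List.mem_permutations.2 (List.Perm.refl h), by simpa using hc⟩
      exact_mod_cast this
    rw [abs_of_nonneg (by positivity)]
    exact div_le_self (by positivity) this
  · rw [abs_zero]
    positivity

theorem weight_map {t : Multiset α → α → Prop} {t' : Multiset β → β → Prop} {φ : α → β}
    {f : Multiset α → ℝ} {f' : Multiset β → ℝ} (ht : ∀ S x, t' (S.map φ) (φ x) ↔ t S x)
    (hf : ∀ S, f' (S.map φ) = f S) (h : List α) :
    weight t' f' (h.map φ) = weight t f h := by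
  classical
  have h1 : (h.map φ).permutations.countP (fun o => Collectable t' o) =
      h.permutations.countP fun o => Collectable t o := by
    rw [← List.map_permutations, List.countP_map]
    refine List.countP_congr fun o _ => ?_
    simp [collectable_map ht]
  unfold weight
  rw [h1, altSum_map, List.length_map]
  simp only [collectable_map ht, hf]

/-- The estimator: the total weight of the subsequences. -/
noncomputable def totalWeight (t : Multiset α → α → Prop) (f : Multiset α → ℝ) (L : List α) : ℝ :=
  (L.sublists.map (weight t f)).sum

theorem totalWeight_map {t : Multiset α → α → Prop} {t' : Multiset β → β → Prop} {φ : α → β}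
    {f : Multiset α → ℝ} {f' : Multiset β → ℝ} (ht : ∀ S x, t' (S.map φ) (φ x) ↔ t S x)
    (hf : ∀ S, f' (S.map φ) = f S) (L : List α) :
    totalWeight t' f' (L.map φ) = totalWeight t f L := by
  rw [totalWeight, totalWeight, List.sublists_map, List.map_map]
  congr 1
  exact List.map_congr_left fun h _ => weight_map ht hf h

/-! ### The kept part of the stream and what it determines -/

open Classical in
/-- The elements of the stream that are kept, where the decision to keep an element depends on
the elements kept before. -/
noncomputable def collect (keep : List α → α → Prop) (stream : List α) : List α :=
  stream.foldl (fun A x => if keep A x then A ++ [x] else A) []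

open Classical in
theorem collect_concat (keep : List α → α → Prop) (A : List α) (x : α) :
    collect keep (A ++ [x]) =
      if keep (collect keep A) x then collect keep A ++ [x] else collect keep A := by
  unfold collect
  rw [List.foldl_append]
  rfl

theorem collect_sublist (keep : List α → α → Prop) (A : List α) :
    (collect keep A).Sublist A := by
  induction A using List.reverseRecOn with
  | nil => simp [collect]
  | append_singleton A x ih =>
    rw [collect_concat]
    split_ifs
    · exact ih.append (List.Sublist.refl _)
    · exact ih.trans (List.sublist_append_left _ _)

/-- To be applied with `P` saying that an edge touches the true ball of one of the first `s` edges,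
which holds for a bounded number of edges. -/
theorem length_collect_le (keep : List α → α → Prop) (s : ℕ) (P : α → Prop) [DecidablePred P]
    (A : List α)
    (hP : ∀ A' x, A' ++ [x] <+: A → s ≤ A'.length → keep (collect keep A') x → P x) :
    (collect keep A).length ≤ s + A.countP P := by
  induction A using List.reverseRecOn with
  | nil => simp [collect]
  | append_singleton A x ih =>
    have ih := ih fun A' y h => hP A' y (h.trans (List.prefix_append _ _))
    rcases lt_or_ge A.length s with hs | hs
    · have := (collect_sublist keep (A ++ [x])).length_le
      rw [List.length_append, List.length_singleton] at this
      omega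
    · rw [collect_concat, List.countP_append]
      split_ifs with hk
      · have := hP A x List.prefix_rfl hs hk
        simp [this]
        omega
      · omega

/-- Keep the first `s` elements, and afterwards all elements that are reached from one of them. -/
def keepRule (t : α → Multiset α → α → Prop) (s : ℕ) (A : List α) (x : α) : Prop :=
  A.length < s ∨ ∃ i < s, ∃ e, A[i]? = some e ∧ t e (A.eraseIdx i) x

theorem collect_keepRule_of_length_le (t : α → Multiset α → α → Prop) (s : ℕ) (A : List α)
    (hA : A.length ≤ s) : collect (keepRule t s) A = A := by
  induction A using List.reverseRecOn with
  | nil => rfl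
  | append_singleton A x ih =>
    rw [List.length_append, List.length_singleton] at hA
    have hk : keepRule t s A x := Or.inl (by omega)
    rw [collect_concat, ih (by omega), if_pos hk]

/-- The first `s` elements are always kept and later ones are only appended, so the roots retain
their positions. -/
theorem take_collect_keepRule (t : α → Multiset α → α → Prop) (s : ℕ) (A : List α) :
    (collect (keepRule t s) A).take s = A.take s := by
  induction A using List.reverseRecOn with
  | nil => rfl
  | append_singleton A x ih =>
    rcases lt_or_ge A.length s with hs | hs
    · rw [collect_keepRule_of_length_le t s _ (by simpa using hs)]
    · have hL : s ≤ (collect (keepRule t s) A).length := by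
        have := congrArg List.length ih
        simp only [List.length_take] at this
        omega
      rw [List.take_append_of_le_length hs, collect_concat]
      split_ifs
      · rw [List.take_append_of_le_length hL, ih]
      · exact ih

theorem getElem?_collect_keepRule (t : α → Multiset α → α → Prop) {s i : ℕ} (hi : i < s)
    (A : List α) : (collect (keepRule t s) A)[i]? = A[i]? := by
  rw [← List.getElem?_take_of_lt hi, take_collect_keepRule, List.getElem?_take_of_lt hi]

/-- The kept elements determine the estimator. -/
theorem sum_sublists_collect {t : α → Multiset α → α → Prop}
    (ht : ∀ e S S' x, (∀ y ∈ S, y ∈ S') → t e S x → t e S' x) {s i : ℕ} (hi : i < s) (A : List α)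
    {e : α} (he : A[i]? = some e) {w : List α → ℝ} (hw : ∀ h, ¬ Collectable (t e) h → w h = 0) :
    (((collect (keepRule t s) A).eraseIdx i).sublists.map w).sum =
      ((A.eraseIdx i).sublists.map w).sum := by
  induction A using List.reverseRecOn generalizing w with
  | nil => simp [collect]
  | append_singleton A x ih =>
    rcases lt_or_ge A.length s with hs | hs
    · rw [collect_keepRule_of_length_le t s _ (by simpa using hs)]
    · have hiA : i < A.length := hi.trans_le hs
      rw [List.getElem?_append_left hiA] at he
      set L := collect (keepRule t s) A with hL
      have heL : L[i]? = some e := by rw [hL, getElem?_collect_keepRule t hi, he]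
      have hiL : i < L.length := (List.getElem?_eq_some_iff.1 heL).1
      have ih1 := ih he hw
      -- The subsequences that end in the new element are handled by the induction hypothesis for a
      -- shifted weight. This is why `w` is general.
      have ih2 := ih he (w := fun h => w (h ++ [x])) fun h hh =>
        hw _ fun hc => hh (collectable_concat.1 hc).1
      have hsplit : ∀ B : List α, ((B ++ [x]).sublists.map w).sum =
          (B.sublists.map w).sum + (B.sublists.map fun h => w (h ++ [x])).sum := by
        intro B
        rw [List.sublists_concat, List.map_append, List.sum_append, List.map_map]
        rfl
      rw [List.eraseIdx_append_of_lt_length hiA, hsplit, ← ih1, ← ih2, collect_concat, ← hL]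
      split_ifs with hk
      · rw [List.eraseIdx_append_of_lt_length hiL, hsplit]
      -- If `x` is dropped, no subsequence of the kept elements followed by `x` is collectable: by
      -- monotonicity of `t`, `x` would then be reached from all kept elements and would have been
      -- kept.
      · rw [left_eq_add]
        refine List.sum_eq_zero fun y hy => ?_
        obtain ⟨h, hh, rfl⟩ := List.mem_map.1 hy
        refine hw _ fun hc => hk (Or.inr ⟨i, hi, e, heL, ?_⟩)
        exact ht e _ _ x (fun y hy => (List.mem_sublists.1 hh).subset hy)
          (collectable_concat.1 hc).2

/-- The subsequences of a list without repetitions correspond to the subsets. -/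
theorem sum_sublists_of_nodup [DecidableEq α] {L : List α} (hL : L.Nodup) (W : List α → ℝ) :
    (L.sublists.map W).sum = ∑ H ∈ L.toFinset.powerset, W (L.filter (· ∈ H)) := by
  induction L generalizing W with
  | nil => simp
  | cons a L ih =>
    have ha : a ∉ L := (List.nodup_cons.1 hL).1
    have ih := fun W => ih (List.nodup_cons.1 hL).2 W
    rw [((List.sublists_cons_perm_append a L).map W).sum_eq, List.map_append, List.sum_append,
      List.map_map, ih W, List.toFinset_cons, Finset.sum_powerset_insert (by simpa using ha)]
    congr 1
    · refine Finset.sum_congr rfl fun H hH => ?_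
      have haH : a ∉ H := fun h => ha (by simpa using Finset.mem_powerset.1 hH h)
      rw [List.filter_cons_of_neg (by simpa using haH)]
    · rw [ih (W ∘ List.cons a)]
      refine Finset.sum_congr rfl fun H hH => ?_
      rw [List.filter_cons_of_pos (by simp), Function.comp]
      congr 2
      refine List.filter_congr fun y hy => ?_
      have : y ≠ a := fun h => ha (h ▸ hy)
      simp [this]

end StreamSampling

/-! ### Averages over random permutations -/

namespace StreamSampling

open Equiv

variable {m : ℕ}

/-- The elements of `H` in the order in which the stream `π` lists them. -/
def subseq (H : Finset (Fin m)) (π : Perm (Fin m)) : List (Fin m) :=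
  (List.ofFn π).filter (· ∈ H)

theorem nodup_subseq (H : Finset (Fin m)) (π : Perm (Fin m)) : (subseq H π).Nodup :=
  (List.nodup_ofFn.2 π.injective).filter _

theorem toFinset_subseq (H : Finset (Fin m)) (π : Perm (Fin m)) : (subseq H π).toFinset = H := by
  ext a
  simp only [subseq, List.mem_toFinset, List.mem_filter, List.mem_ofFn, decide_eq_true_eq]
  exact ⟨fun h => h.2, fun h => ⟨⟨π.symm a, by simp⟩, h⟩⟩

theorem length_subseq (H : Finset (Fin m)) (π : Perm (Fin m)) : (subseq H π).length = H.card := by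
  rw [← List.toFinset_card_of_nodup (nodup_subseq H π), toFinset_subseq]

theorem subseq_mul {H : Finset (Fin m)} {τ : Perm (Fin m)} (hτ : ∀ a, τ a ∈ H ↔ a ∈ H)
    (π : Perm (Fin m)) : subseq H (τ * π) = (subseq H π).map τ := by
  have : (List.ofFn (τ * π)) = (List.ofFn π).map τ := by
    rw [List.map_ofFn]
    rfl
  rw [subseq, subseq, this, List.filter_map]
  congr 2
  funext a
  simp [hτ]

/-- The orderings of a list without repetitions are its images under the permutations of its
set of elements. -/
theorem sum_perm_map {H : Finset (Fin m)} {l : List (Fin m)} (hl : l.Nodup)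
    (hH : l.toFinset = H) (W : List (Fin m) → ℝ) :
    ∑ τ : Perm {x // x ∈ H}, W (l.map (Perm.ofSubtype τ)) = (l.permutations.map W).sum := by
  have hmem : ∀ a, a ∈ l ↔ a ∈ H := fun a => by rw [← hH, List.mem_toFinset]
  have hinj : Function.Injective fun τ : Perm {x // x ∈ H} => l.map (Perm.ofSubtype τ) := by
    intro τ τ' h
    ext ⟨a, ha⟩
    have := List.map_inj_left.1 h a ((hmem a).2 ha)
    rw [Perm.ofSubtype_apply_of_mem _ ha, Perm.ofSubtype_apply_of_mem _ ha] at this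
    exact congrArg Fin.val this
  have himg : (Finset.univ.image fun τ : Perm {x // x ∈ H} => l.map (Perm.ofSubtype τ)) =
      l.permutations.toFinset := by
    refine Finset.eq_of_subset_of_card_le ?_ ?_
    · intro o ho
      obtain ⟨τ, -, rfl⟩ := Finset.mem_image.1 ho
      rw [List.mem_toFinset, List.mem_permutations]
      refine (List.perm_ext_iff_of_nodup (hl.map (Equiv.injective _)) hl).2 fun a => ?_
      rw [List.mem_map]
      constructor
      · rintro ⟨b, hb, rfl⟩
        rw [Perm.ofSubtype_apply_of_mem _ ((hmem b).1 hb), hmem]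
        exact (τ _).2
      · intro ha
        refine ⟨(Perm.ofSubtype τ).symm a, ?_, by simp⟩
        rw [← Perm.inv_def, ← map_inv, Perm.ofSubtype_apply_of_mem _ ((hmem a).1 ha), hmem]
        exact (τ⁻¹ _).2
    · rw [Finset.card_image_of_injective _ hinj, Finset.card_univ, Fintype.card_perm,
        Fintype.card_coe, List.toFinset_card_of_nodup (List.nodup_permutations l hl),
        List.length_permutations, ← hH, List.toFinset_card_of_nodup hl]
  rw [← List.sum_toFinset W (List.nodup_permutations l hl), ← himg, Finset.sum_image
    fun _ _ _ _ h => hinj h]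

/-- Averaging over the orderings of `H`. -/
theorem sum_mul_subseq (H : Finset (Fin m)) (W : List (Fin m) → ℝ) (A : ℝ)
    (hA : ∀ l : List (Fin m), l.Nodup → l.toFinset = H →
      (l.permutations.map W).sum = (H.card.factorial : ℝ) * A)
    (Y : Perm (Fin m) → ℝ) (hY : ∀ τ π, (∀ a ∉ H, τ a = a) → Y (τ * π) = Y π) :
    ∑ π, Y π * W (subseq H π) = (∑ π, Y π) * A := by
  -- Renaming the elements of `H` by `τ` is a bijection on the streams that does not affect `Y`.
  -- Summing over all `τ` then runs through all orderings of `H`.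
  have h1 : ∀ τ : Perm {x // x ∈ H}, ∑ π, Y π * W (subseq H π) =
      ∑ π, Y π * W ((subseq H π).map (Perm.ofSubtype τ)) := by
    intro τ
    rw [← Equiv.sum_comp (Equiv.mulLeft (Perm.ofSubtype τ))]
    refine Finset.sum_congr rfl fun π _ => ?_
    rw [Equiv.coe_mulLeft, hY _ _ fun a ha => Perm.ofSubtype_apply_of_not_mem _ ha, subseq_mul]
    intro a
    by_cases ha : a ∈ H
    · simp [Perm.ofSubtype_apply_of_mem _ ha, ha]
    · rw [Perm.ofSubtype_apply_of_not_mem _ ha]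
  have h2 : (H.card.factorial : ℝ) * ∑ π, Y π * W (subseq H π) =
      (H.card.factorial : ℝ) * ((∑ π, Y π) * A) := by
    calc (H.card.factorial : ℝ) * ∑ π, Y π * W (subseq H π)
        = ∑ τ : Perm {x // x ∈ H}, ∑ π, Y π * W (subseq H π) := by
          rw [Finset.sum_const, Finset.card_univ, Fintype.card_perm, Fintype.card_coe,
            nsmul_eq_mul]
      _ = ∑ τ : Perm {x // x ∈ H}, ∑ π, Y π * W ((subseq H π).map (Perm.ofSubtype τ)) :=
          Finset.sum_congr rfl fun τ _ => h1 τ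
      _ = ∑ π, Y π * ((H.card.factorial : ℝ) * A) := by
          rw [Finset.sum_comm]
          refine Finset.sum_congr rfl fun π _ => ?_
          rw [← Finset.mul_sum, sum_perm_map (nodup_subseq H π) (toFinset_subseq H π) W,
            hA _ (nodup_subseq H π) (toFinset_subseq H π)]
      _ = (H.card.factorial : ℝ) * ((∑ π, Y π) * A) := by
          rw [← Finset.sum_mul]
          ring
  exact mul_left_cancel₀ (by positivity) h2

theorem exists_perm_pair {i j a b : Fin m} (hij : i ≠ j) (hab : a ≠ b) :
    ∃ τ : Perm (Fin m), τ i = a ∧ τ j = b := by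
  have hj : swap i a j ≠ a := fun h => hij (by
    have := congrArg (swap i a) h
    simpa using this.symm)
  refine ⟨swap (swap i a j) b * swap i a, ?_, ?_⟩
  · simp [Perm.mul_apply, swap_apply_of_ne_of_ne hj.symm hab]
  · simp [Perm.mul_apply]

theorem sum_perm_apply (i : Fin m) (g : Fin m → ℝ) :
    (m : ℝ) * ∑ π : Perm (Fin m), g (π i) = (m.factorial : ℝ) * ∑ a, g a := by
  have h1 : ∀ j, ∑ π : Perm (Fin m), g (π i) = ∑ π : Perm (Fin m), g (π j) := by
    intro j
    rw [← Equiv.sum_comp (Equiv.mulRight (swap i j))]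
    simp [Perm.mul_apply]
  calc (m : ℝ) * ∑ π : Perm (Fin m), g (π i)
      = ∑ j : Fin m, ∑ π : Perm (Fin m), g (π j) := by
        rw [← Finset.sum_congr rfl fun j _ => h1 j]
        simp
    _ = ∑ π : Perm (Fin m), ∑ a, g a := by
        rw [Finset.sum_comm]
        exact Finset.sum_congr rfl fun π _ => Equiv.sum_comp π g
    _ = (m.factorial : ℝ) * ∑ a, g a := by
        simp [Fintype.card_perm]

/-- Permutations act transitively on ordered pairs of distinct positions, so the pair of entries is
uniform off the diagonal. -/
theorem sum_perm_apply_pair {i j : Fin m} (hij : i ≠ j) (g : Fin m × Fin m → ℝ) :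
    ((m : ℝ) * (m - 1)) * ∑ π : Perm (Fin m), g (π i, π j) =
      (m.factorial : ℝ) * ∑ a ∈ Finset.univ.offDiag, g a := by
  have h1 : ∀ b ∈ (Finset.univ : Finset (Fin m)).offDiag,
      ∑ π : Perm (Fin m), g (π b.1, π b.2) = ∑ π : Perm (Fin m), g (π i, π j) := by
    intro b hb
    obtain ⟨τ, h1, h2⟩ := exists_perm_pair hij (Finset.mem_offDiag.1 hb).2.2
    rw [← Equiv.sum_comp (Equiv.mulRight τ) fun π : Perm (Fin m) => g (π i, π j)]
    simp [Perm.mul_apply, h1, h2]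
  have h2 : (((Finset.univ : Finset (Fin m)).offDiag.card : ℕ) : ℝ) = (m : ℝ) * (m - 1) := by
    rw [Finset.offDiag_card, Finset.card_univ, Fintype.card_fin, Nat.cast_sub (Nat.le_mul_self m)]
    push_cast
    ring
  calc ((m : ℝ) * (m - 1)) * ∑ π : Perm (Fin m), g (π i, π j)
      = ∑ b ∈ (Finset.univ : Finset (Fin m)).offDiag, ∑ π : Perm (Fin m), g (π b.1, π b.2) := by
        rw [Finset.sum_congr rfl h1, Finset.sum_const, nsmul_eq_mul, h2]
    _ = ∑ π : Perm (Fin m), ∑ a ∈ Finset.univ.offDiag, g a := by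
        rw [Finset.sum_comm]
        refine Finset.sum_congr rfl fun π _ => ?_
        refine Finset.sum_bij' (fun b _ => (π b.1, π b.2)) (fun b _ => (π.symm b.1, π.symm b.2))
          ?_ ?_ ?_ ?_ ?_ <;> simp
    _ = (m.factorial : ℝ) * ∑ a ∈ Finset.univ.offDiag, g a := by
        simp [Fintype.card_perm]

/-! ### Expectation and variance of the estimator -/

/-- A stream of `m` elements together with a local statistic `f` of its elements. -/
structure LocalStatistic (m : ℕ) (α : Type) where
  ρ : Fin m → α
  t : α → Multiset α → α → Prop
  f : α → Multiset α → ℝ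
  isLocal : ∀ e, IsLocal (t e) (f e)
  f_nonneg : ∀ e S, 0 ≤ f e S
  f_le_one : ∀ e S, f e S ≤ 1
  /-- the elements that can be reached from a given one -/
  loc : Fin m → Finset (Fin m)
  self_mem_loc : ∀ a, a ∈ loc a
  mem_loc : ∀ a b (H : Finset (Fin m)), t (ρ a) (H.val.map ρ) (ρ b) → b ∈ loc a
  loc_symm : ∀ a b, b ∈ loc a → a ∈ loc b
  Δ : ℕ
  card_loc_le : ∀ a, (loc a).card ≤ Δ

namespace LocalStatistic

variable {α : Type} (S : LocalStatistic m α)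

theorem abs_f_le (e : α) (M : Multiset α) : |S.f e M| ≤ 1 := by
  rw [abs_of_nonneg (S.f_nonneg e M)]
  exact S.f_le_one e M

/-- The value of the statistic at an element. -/
noncomputable def value (a : Fin m) : ℝ := S.f (S.ρ a) ((Finset.univ.erase a).val.map S.ρ)

theorem value_nonneg (a : Fin m) : 0 ≤ S.value a := S.f_nonneg _ _

theorem value_le_one (a : Fin m) : S.value a ≤ 1 := S.f_le_one _ _

/-- The average of the statistic. -/
noncomputable def mean : ℝ := (∑ a, S.value a) / m

/-- The weight of a subsequence, as seen from `a`. -/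
noncomputable def w (a : Fin m) (h : List (Fin m)) : ℝ :=
  weight (S.t (S.ρ a)) (S.f (S.ρ a)) (h.map S.ρ)

/-- The estimate of the value at `a` from the order `π`. -/
noncomputable def est (a : Fin m) (π : Perm (Fin m)) : ℝ :=
  ∑ H ∈ ((S.loc a).erase a).powerset, S.w a (subseq H π)

/-- The bound for the estimates. -/
noncomputable def bound : ℝ := 2 ^ S.Δ * (2 ^ S.Δ * S.Δ.factorial)

/-- In a collectable ordering every element is reached from `a`, hence lies in `loc a`. So only
boundedly many sets `H` contribute. -/
theorem w_subseq_eq_zero {a : Fin m} {H : Finset (Fin m)} (hH : ¬ H ⊆ S.loc a)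
    (π : Perm (Fin m)) : S.w a (subseq H π) = 0 := by
  refine weight_of_not_collectable fun hc => hH fun b hb => ?_
  rw [← toFinset_subseq H π, List.mem_toFinset] at hb
  obtain ⟨p, q, hpq⟩ := List.append_of_mem hb
  have hnd : p.Nodup := (hpq ▸ nodup_subseq H π).of_append_left
  have := hc (p.map S.ρ) (S.ρ b) ⟨q.map S.ρ, by simp [hpq]⟩
  refine S.mem_loc a b p.toFinset ?_
  rwa [List.toFinset_val, List.dedup_eq_self.2 hnd, Multiset.map_coe]

theorem sum_powerset_w (a : Fin m) (π : Perm (Fin m)) :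
    ∑ H ∈ (Finset.univ.erase a).powerset, S.w a (subseq H π) = S.est a π := by
  symm
  refine Finset.sum_subset (Finset.powerset_mono.2 (Finset.erase_subset_erase _
    (Finset.subset_univ _))) fun H hH hH' => S.w_subseq_eq_zero (fun h => hH' ?_) π
  rw [Finset.mem_powerset] at hH ⊢
  exact fun b hb => Finset.mem_erase.2 ⟨(Finset.mem_erase.1 (hH hb)).1, h hb⟩

/-- The estimate is the total weight of the subsequences of the rest of the stream. -/
theorem totalWeight_eq_est (π : Perm (Fin m)) (i : Fin m) :
    totalWeight (S.t (S.ρ (π i))) (S.f (S.ρ (π i)))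
      ((List.ofFn (S.ρ ∘ π)).eraseIdx i) = S.est (π i) π := by
  have hnd : (List.ofFn π).Nodup := List.nodup_ofFn.2 π.injective
  have h1 : (List.ofFn π).eraseIdx i = (List.ofFn π).filter (· != π i) := by
    rw [← hnd.erase_eq_filter]
    have := hnd.erase_getElem (i := (i : ℕ)) (by simp)
    simpa using this.symm
  have h2 : ((List.ofFn π).eraseIdx i).toFinset = Finset.univ.erase (π i) := by
    ext a
    rw [h1, List.mem_toFinset, List.mem_filter, List.mem_ofFn, Finset.mem_erase]
    simp only [bne_iff_ne, ne_eq, Finset.mem_univ, and_true]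
    exact ⟨fun h => h.2, fun h => ⟨⟨π.symm a, by simp⟩, h⟩⟩
  rw [← S.sum_powerset_w, ← h2, ← List.map_ofFn, List.eraseIdx_map, totalWeight,
    List.sublists_map, List.map_map]
  refine (sum_sublists_of_nodup (hnd.sublist (List.eraseIdx_sublist _ _)) _).trans ?_
  refine Finset.sum_congr rfl fun H hH => ?_
  rw [Finset.mem_powerset, h2] at hH
  rw [w, Function.comp, h1, List.filter_filter, subseq]
  congr 2
  refine List.filter_congr fun a _ => ?_
  by_cases ha : a ∈ H
  · simp [ha, (Finset.mem_erase.1 (hH ha)).1]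
  · simp [ha]

theorem abs_est_le (a : Fin m) (π : Perm (Fin m)) : |S.est a π| ≤ S.bound := by
  have hc : ((S.loc a).erase a).card ≤ S.Δ :=
    (Finset.card_le_card (Finset.erase_subset _ _)).trans (S.card_loc_le a)
  calc |S.est a π| ≤ ∑ H ∈ ((S.loc a).erase a).powerset, |S.w a (subseq H π)| :=
        Finset.abs_sum_le_sum_abs _ _
    _ ≤ ∑ H ∈ ((S.loc a).erase a).powerset, (2 ^ S.Δ * S.Δ.factorial : ℝ) := by
        refine Finset.sum_le_sum fun H hH => ?_
        have hl : ((subseq H π).map S.ρ).length ≤ S.Δ := by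
          rw [List.length_map, length_subseq]
          exact (Finset.card_le_card (Finset.mem_powerset.1 hH)).trans hc
        refine (abs_weight_le _ (S.abs_f_le _) _).trans ?_
        refine mul_le_mul (pow_le_pow_right₀ (by norm_num) hl) ?_ (by positivity) (by positivity)
        exact_mod_cast Nat.factorial_le hl
    _ ≤ S.bound := by
        rw [Finset.sum_const, Finset.card_powerset, nsmul_eq_mul, bound]
        refine mul_le_mul_of_nonneg_right ?_ (by positivity)
        push_cast
        exact pow_le_pow_right₀ (by norm_num) hc

theorem sum_mul_w (a : Fin m) (H : Finset (Fin m)) (Y : Perm (Fin m) → ℝ)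
    (hY : ∀ τ π, (∀ b ∉ H, τ b = b) → Y (τ * π) = Y π) :
    ∑ π, Y π * S.w a (subseq H π) =
      (∑ π, Y π) * altSum (H.toList.map S.ρ) (S.f (S.ρ a)) := by
  refine sum_mul_subseq H (S.w a) _ (fun l hl hH => ?_) Y hY
  have hp : l.Perm H.toList := by
    refine (List.perm_ext_iff_of_nodup hl H.nodup_toList).2 fun b => ?_
    rw [Finset.mem_toList, ← hH, List.mem_toFinset]
  have h1 : l.permutations.map (S.w a) =
      (l.map S.ρ).permutations.map (weight (S.t (S.ρ a)) (S.f (S.ρ a))) := by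
    rw [← List.map_permutations, List.map_map]
    rfl
  rw [h1, sum_permutations_weight (S.isLocal _), altSum_perm (hp.map S.ρ), List.length_map,
    ← List.toFinset_card_of_nodup hl, hH]

/-- Möbius inversion runs over all sets avoiding `a`. Those not contained in `loc a` drop out
because their alternating sum is the average of weights that are identically 0. -/
theorem sum_altSum (a : Fin m) :
    ∑ H ∈ ((S.loc a).erase a).powerset, altSum (H.toList.map S.ρ) (S.f (S.ρ a)) = S.value a := by
  rw [value, ← sum_powerset_altSum S.ρ _ (S.f (S.ρ a))]
  refine Finset.sum_subset (Finset.powerset_mono.2 (Finset.erase_subset_erase _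
    (Finset.subset_univ _))) fun H hH hH' => ?_
  have hn : ¬ H ⊆ S.loc a := fun h => hH' (by
    rw [Finset.mem_powerset] at hH ⊢
    exact fun b hb => Finset.mem_erase.2 ⟨(Finset.mem_erase.1 (hH hb)).1, h hb⟩)
  have h := S.sum_mul_w a H (fun _ => 1) (fun _ _ _ => rfl)
  simp only [S.w_subseq_eq_zero hn, mul_zero, Finset.sum_const_zero] at h
  have h0 : (∑ _π : Perm (Fin m), (1 : ℝ)) ≠ 0 := by simp
  exact (mul_eq_zero.1 h.symm).resolve_left h0

/-- Unbiasedness under conditioning. In the applications `Y` indicates that given elements stand at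
given positions, possibly times the estimate at a far away element; such a `Y` does not change when
the elements of `(S.loc a).erase a` are permuted. -/
theorem sum_mul_est (a : Fin m) (Y : Perm (Fin m) → ℝ)
    (hY : ∀ τ π, (∀ b ∉ (S.loc a).erase a, τ b = b) → Y (τ * π) = Y π) :
    ∑ π, Y π * S.est a π = (∑ π, Y π) * S.value a := by
  simp only [est, Finset.mul_sum]
  rw [Finset.sum_comm, ← S.sum_altSum, Finset.mul_sum]
  refine Finset.sum_congr rfl fun H hH => S.sum_mul_w a H Y fun τ π h => hY τ π fun b hb => h b ?_
  exact fun hbH => hb (Finset.mem_powerset.1 hH hbH)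

/-- The estimate depends only on the order in which the stream lists the elements of `(S.loc
a).erase a`, and renaming other elements leaves it alone. -/
theorem est_mul {a : Fin m} {τ : Perm (Fin m)} (hτ : ∀ b ∈ (S.loc a).erase a, τ b = b)
    (π : Perm (Fin m)) : S.est a (τ * π) = S.est a π := by
  refine Finset.sum_congr rfl fun H hH => ?_
  have hfix : ∀ b ∈ H, τ b = b := fun b hb => hτ b (Finset.mem_powerset.1 hH hb)
  have hmem : ∀ b, τ b ∈ H ↔ b ∈ H := by
    intro b
    constructor
    · intro h
      have := hfix _ h
      rwa [← τ.injective this]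
    · intro h
      rwa [hfix b h]
  rw [subseq_mul hmem]
  congr 1
  conv_rhs => rw [← List.map_id (subseq H π)]
  refine List.map_congr_left fun b hb => hfix b ?_
  rwa [← List.mem_toFinset, toFinset_subseq] at hb

theorem sum_est (i : Fin m) : ∑ π, S.est (π i) π = (m.factorial : ℝ) * S.mean := by
  have hm : (m : ℝ) ≠ 0 := by
    have := i.pos
    positivity
  have h1 : ∑ π, S.est (π i) π = ∑ π : Perm (Fin m), S.value (π i) := by
    have h2 : ∀ g : Fin m → Perm (Fin m) → ℝ, ∑ π : Perm (Fin m), g (π i) π =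
        ∑ a, ∑ π : Perm (Fin m), (if π i = a then 1 else 0) * g a π := by
      intro g
      rw [Finset.sum_comm]
      simp
    rw [h2 fun a π => S.est a π, h2 fun a _ => S.value a]
    refine Finset.sum_congr rfl fun a _ => ?_
    rw [S.sum_mul_est, Finset.sum_mul]
    intro τ π hτ
    have : τ a = a := hτ a (by simp)
    have h3 : (τ * π) i = a ↔ π i = a := by
      rw [Perm.mul_apply]
      nth_rewrite 1 [← this]
      exact τ.injective.eq_iff
    simp only [h3]
  have := sum_perm_apply i S.value
  rw [h1, mean]
  field_simp
  linarith

/-- Distinct positions are nearly uncorrelated. -/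
theorem sum_est_mul_est_le {i j : Fin m} (hij : i ≠ j) :
    ((m : ℝ) * (m - 1)) * ∑ π, S.est (π i) π * S.est (π j) π ≤
      (m.factorial : ℝ) * ((∑ a, S.value a) ^ 2 + S.bound ^ 2 * (m * S.Δ ^ 2)) := by
  classical
  set g : Fin m × Fin m → ℝ := fun e => S.value e.1 * S.value e.2 +
    if Disjoint (S.loc e.1) (S.loc e.2) then 0 else S.bound ^ 2 with hg
  have hb0 : 0 ≤ S.bound := by unfold bound; positivity
  have h1 : ∑ π, S.est (π i) π * S.est (π j) π ≤ ∑ π : Perm (Fin m), g (π i, π j) := by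
    have h2 : ∀ g : Fin m × Fin m → Perm (Fin m) → ℝ, ∑ π : Perm (Fin m), g (π i, π j) π =
        ∑ e, ∑ π : Perm (Fin m), (if (π i, π j) = e then 1 else 0) * g e π := by
      intro g
      rw [Finset.sum_comm]
      simp
    rw [h2 fun e π => S.est e.1 π * S.est e.2 π, h2 fun e _ => g e]
    refine Finset.sum_le_sum fun e _ => ?_
    -- With disjoint neighborhoods both estimates can be replaced by their values, one after the
    -- other, given the entries at positions `i` and `j`. Otherwise the product is bounded crudely.
    by_cases hd : Disjoint (S.loc e.1) (S.loc e.2)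
    · have hd1 : ∀ b ∈ S.loc e.1, b ∉ S.loc e.2 := fun b hb hb' =>
        Finset.disjoint_left.1 hd hb hb'
      have hne : ∀ τ π : Perm (Fin m), τ e.1 = e.1 → τ e.2 = e.2 →
          (((τ * π) i, (τ * π) j) = e ↔ (π i, π j) = e) := by
        intro τ π h1 h2
        rw [Prod.ext_iff, Prod.ext_iff]
        refine and_congr ?_ ?_
        · show τ (π i) = e.1 ↔ π i = e.1
          nth_rewrite 1 [← h1]
          exact τ.injective.eq_iff
        · show τ (π j) = e.2 ↔ π j = e.2
          nth_rewrite 1 [← h2]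
          exact τ.injective.eq_iff
      have h3 := S.sum_mul_est e.1
        (fun π => (if (π i, π j) = e then 1 else 0) * S.est e.2 π) fun τ π hτ => by
          have ha : τ e.1 = e.1 := hτ _ (by simp)
          have hb : τ e.2 = e.2 := hτ _ fun h =>
            hd1 _ (Finset.mem_of_mem_erase h) (S.self_mem_loc _)
          simp only [hne τ π ha hb]
          rw [S.est_mul fun b hb => hτ b fun h =>
            hd1 b (Finset.mem_of_mem_erase h) (Finset.mem_of_mem_erase hb)]
      have h4 := S.sum_mul_est e.2
        (fun π => (if (π i, π j) = e then 1 else 0)) fun τ π hτ => by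
          have hb : τ e.2 = e.2 := hτ _ (by simp)
          have ha : τ e.1 = e.1 := hτ _ fun h =>
            hd1 _ (S.self_mem_loc _) (Finset.mem_of_mem_erase h)
          simp only [hne τ π ha hb]
      rw [h4] at h3
      refine le_of_eq ?_
      simp only [hg, hd, if_true, add_zero]
      rw [← Finset.sum_mul]
      calc _ = ∑ π : Perm (Fin m), (if (π i, π j) = e then 1 else 0) * S.est e.2 π *
            S.est e.1 π := Finset.sum_congr rfl fun π _ => by ring
        _ = _ := by rw [h3]; ring
    · refine Finset.sum_le_sum fun π _ => mul_le_mul_of_nonneg_left ?_ (by split_ifs <;> simp)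
      simp only [hg, hd, if_false]
      have h3 := S.abs_est_le e.1 π
      have h4 := S.abs_est_le e.2 π
      calc S.est e.1 π * S.est e.2 π ≤ |S.est e.1 π * S.est e.2 π| := le_abs_self _
        _ = |S.est e.1 π| * |S.est e.2 π| := abs_mul _ _
        _ ≤ S.bound * S.bound := mul_le_mul h3 h4 (abs_nonneg _) hb0
        _ ≤ _ := by
          have := mul_nonneg (S.value_nonneg e.1) (S.value_nonneg e.2)
          nlinarith
  have hm : (0 : ℝ) ≤ (m : ℝ) * (m - 1) := by
    have : (1 : ℝ) ≤ m := by exact_mod_cast i.pos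
    nlinarith
  refine (mul_le_mul_of_nonneg_left h1 hm).trans ?_
  rw [sum_perm_apply_pair hij]
  refine mul_le_mul_of_nonneg_left ?_ (by positivity)
  calc ∑ a ∈ Finset.univ.offDiag, g a ≤ ∑ a, g a :=
        Finset.sum_le_sum_of_subset_of_nonneg (Finset.subset_univ _) fun e _ _ => by
          have := mul_nonneg (S.value_nonneg e.1) (S.value_nonneg e.2)
          simp only [hg]
          split_ifs <;> positivity
    _ = (∑ a, S.value a) ^ 2 + ∑ a : Fin m, ∑ b : Fin m,
        (if Disjoint (S.loc a) (S.loc b) then 0 else S.bound ^ 2) := by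
          simp only [hg, Finset.sum_add_distrib, Fintype.sum_prod_type]
          rw [sq (∑ a, S.value a), Finset.sum_mul_sum]
    _ ≤ _ := by
      gcongr
      calc ∑ a : Fin m, ∑ b : Fin m,
            (if Disjoint (S.loc a) (S.loc b) then 0 else S.bound ^ 2)
          ≤ ∑ a : Fin m, S.bound ^ 2 * (S.Δ : ℝ) ^ 2 := by
            refine Finset.sum_le_sum fun a _ => ?_
            rw [Finset.sum_ite, Finset.sum_const_zero, zero_add, Finset.sum_const, nsmul_eq_mul,
              mul_comm]
            refine mul_le_mul_of_nonneg_left ?_ (by positivity)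
            -- A common element `c` lies in `loc a`, and by symmetry `b` lies in `loc c`, which
            -- leaves at most `Δ` ^ 2 choices of `b`.
            have hsub : (Finset.univ.filter fun b => ¬ Disjoint (S.loc a) (S.loc b)) ⊆
                (S.loc a).biUnion S.loc := by
              intro b hb
              obtain ⟨c, hc, hc'⟩ := Finset.not_disjoint_iff.1 (Finset.mem_filter.1 hb).2
              exact Finset.mem_biUnion.2 ⟨c, hc, S.loc_symm _ _ hc'⟩
            have hc : ((S.loc a).biUnion S.loc).card ≤ S.Δ * S.Δ :=
              (Finset.card_biUnion_le_card_mul _ _ _ fun c _ => S.card_loc_le c).trans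
                (Nat.mul_le_mul_right _ (S.card_loc_le a))
            have := (Finset.card_le_card hsub).trans hc
            rw [sq]
            exact_mod_cast this
        _ = S.bound ^ 2 * (m * S.Δ ^ 2) := by
            rw [Finset.sum_const, Finset.card_univ, Fintype.card_fin, nsmul_eq_mul]
            ring

theorem mean_nonneg : 0 ≤ S.mean :=
  div_nonneg (Finset.sum_nonneg fun a _ => S.value_nonneg a) (Nat.cast_nonneg m)

theorem mean_le_one : S.mean ≤ 1 := by
  refine div_le_one_of_le₀ ?_ (Nat.cast_nonneg m)
  calc ∑ a, S.value a ≤ ∑ _a : Fin m, (1 : ℝ) := Finset.sum_le_sum fun a _ => S.value_le_one a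
    _ = m := by simp

/-- Sampling without replacement replaces `mean` ^ 2 by at most `mean` ^ 2 * m / (m - 1). The excess
is at most 1 / (m - 1), whence the summand 1; the other summand comes from pairs with overlapping
neighborhoods. -/
theorem cov_le {i j : Fin m} (hij : i ≠ j) :
    ((m : ℝ) - 1) * ∑ π, (S.est (π i) π - S.mean) * (S.est (π j) π - S.mean) ≤
      (m.factorial : ℝ) * (1 + S.bound ^ 2 * S.Δ ^ 2) := by
  have hm : (0 : ℝ) < m := by exact_mod_cast i.pos
  have h1 : ∑ π, (S.est (π i) π - S.mean) * (S.est (π j) π - S.mean) =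
      ∑ π, S.est (π i) π * S.est (π j) π - (m.factorial : ℝ) * S.mean ^ 2 := by
    have : ∀ π : Perm (Fin m), (S.est (π i) π - S.mean) * (S.est (π j) π - S.mean) =
        S.est (π i) π * S.est (π j) π - S.mean * S.est (π i) π - S.mean * S.est (π j) π +
          S.mean ^ 2 := fun π => by ring
    simp only [this, Finset.sum_add_distrib, Finset.sum_sub_distrib, ← Finset.mul_sum, S.sum_est,
      Finset.sum_const, Finset.card_univ, Fintype.card_perm, Fintype.card_fin, nsmul_eq_mul]
    ring
  have h2 := S.sum_est_mul_est_le hij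
  have h3 : ∑ a, S.value a = m * S.mean := by
    rw [mean]
    field_simp
  rw [h3] at h2
  have h4 : S.mean ^ 2 ≤ 1 := pow_le_one₀ S.mean_nonneg S.mean_le_one
  have h5 : (m : ℝ) * (((m : ℝ) - 1) *
      ∑ π, (S.est (π i) π - S.mean) * (S.est (π j) π - S.mean)) ≤
      m * ((m.factorial : ℝ) * (1 + S.bound ^ 2 * S.Δ ^ 2)) := by
    rw [h1]
    have h6 : (m.factorial : ℝ) * m * S.mean ^ 2 ≤ (m.factorial : ℝ) * m * 1 :=
      mul_le_mul_of_nonneg_left h4 (by positivity)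
    linarith
  exact le_of_mul_le_mul_left h5 hm

/-- The second moment of the error of the average of the first `s` estimates. -/
theorem second_moment_le {s : ℕ} (hs : 2 ≤ s) (hsm : s ≤ m) :
    ∑ π, (∑ i : Fin s, (S.est (π (Fin.castLE hsm i)) π - S.mean)) ^ 2 ≤
      (m.factorial : ℝ) * (s * ((S.bound + 1) ^ 2 + 2 * (1 + S.bound ^ 2 * S.Δ ^ 2))) := by
  set K : ℝ := 1 + S.bound ^ 2 * S.Δ ^ 2 with hK
  have hK0 : 0 ≤ K := by positivity
  have hs' : (2 : ℝ) ≤ s := by exact_mod_cast hs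
  have hsm' : (s : ℝ) ≤ m := by exact_mod_cast hsm
  set Z : Fin s → Perm (Fin m) → ℝ := fun i π => S.est (π (Fin.castLE hsm i)) π - S.mean with hZ
  have hdiag : ∀ i, ∑ π, Z i π * Z i π ≤ (m.factorial : ℝ) * (S.bound + 1) ^ 2 := by
    intro i
    calc ∑ π, Z i π * Z i π ≤ ∑ _π : Perm (Fin m), (S.bound + 1) ^ 2 := by
          refine Finset.sum_le_sum fun π _ => ?_
          rw [← sq]
          refine sq_le_sq' ?_ ?_ <;>
          have h1 := abs_le.1 (S.abs_est_le (π (Fin.castLE hsm i)) π) <;>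
          have h2 := S.mean_nonneg <;> have h3 := S.mean_le_one <;>
          simp only [hZ] <;> linarith [h1.1, h1.2]
      _ = _ := by simp [Fintype.card_perm]
  have hoff : ∀ i j, i ≠ j → ∑ π, Z i π * Z j π ≤ (m.factorial : ℝ) * (2 * K / s) := by
    intro i j hij
    have h1 := S.cov_le (i := Fin.castLE hsm i) (j := Fin.castLE hsm j)
      fun h => hij (Fin.castLE_injective hsm h)
    have h2 : ∑ π, Z i π * Z j π ≤ (m.factorial : ℝ) * K / ((m : ℝ) - 1) := by
      rw [le_div_iff₀ (by linarith), mul_comm]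
      exact h1
    refine h2.trans ?_
    rw [mul_div_assoc]
    refine mul_le_mul_of_nonneg_left ?_ (by positivity)
    -- Since 2 ≤ s ≤ m, one has s ≤ 2(m - 1). So the s ^ 2 covariances together contribute only
    -- O(s).
    rw [div_le_div_iff₀ (by linarith) (by linarith)]
    nlinarith
  calc ∑ π, (∑ i, Z i π) ^ 2 = ∑ i, ∑ j, ∑ π, Z i π * Z j π := by
        simp only [sq, Finset.sum_mul_sum]
        rw [Finset.sum_comm]
        exact Finset.sum_congr rfl fun i _ => Finset.sum_comm
    _ ≤ ∑ i : Fin s, ∑ j : Fin s, ((if i = j then (m.factorial : ℝ) * (S.bound + 1) ^ 2 else 0) +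
          (m.factorial : ℝ) * (2 * K / s)) := by
        refine Finset.sum_le_sum fun i _ => Finset.sum_le_sum fun j _ => ?_
        split_ifs with h
        · subst h
          have : 0 ≤ (m.factorial : ℝ) * (2 * K / s) := by positivity
          linarith [hdiag i]
        · rw [zero_add]
          exact hoff i j h
    _ = _ := by
        simp only [Finset.sum_add_distrib, Finset.sum_ite_eq, Finset.mem_univ, if_true,
          Finset.sum_const, Finset.card_univ, Fintype.card_fin, nsmul_eq_mul]
        have : (s : ℝ) ≠ 0 := by positivity
        field_simp

end LocalStatistic

end StreamSampling

/-! ### A machine that stores boundedly many edges -/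

namespace StreamSampling

variable {k n n' : ℕ}

/-- An endpoint of an entry of a list of edges. -/
def entry (L : List (Fin n × Fin n)) (a : ℕ × Bool) : Option (Fin n) :=
  (L[a.1]?).map fun x => if a.2 then x.2 else x.1

/-- Two lists of edges of colored graphs agree up to the names of the vertices. -/
def SamePattern (χ : Fin n → Fin k) (χ' : Fin n' → Fin k) (L : List (Fin n × Fin n))
    (L' : List (Fin n' × Fin n')) : Prop :=
  (∀ a b, entry L a = entry L b ↔ entry L' a = entry L' b) ∧
    ∀ a, (entry L a).map χ = (entry L' a).map χ'

/-- A function of lists of edges of colored graphs that does not depend on the names of the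
vertices. -/
def PatternInvariant {γ : Type u}
    (Φ : ∀ n, (Fin n → Fin k) → List (Fin n × Fin n) → γ) : Prop :=
  ∀ n n' (χ : Fin n → Fin k) (χ' : Fin n' → Fin k) (L : List (Fin n × Fin n))
    (L' : List (Fin n' × Fin n')), SamePattern χ χ' L L' → Φ n χ L = Φ n' χ' L'

theorem entry_eq_none_iff (L : List (Fin n × Fin n)) (a : ℕ × Bool) :
    entry L a = none ↔ L.length ≤ a.1 := by
  simp [entry]

theorem exists_entry_eq {L : List (Fin n × Fin n)} {a : ℕ × Bool} (ha : a.1 < L.length) :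
    ∃ v, entry L a = some v := by
  rw [← Option.ne_none_iff_exists', Ne, entry_eq_none_iff]
  omega

section Machine

/-- The registers: one that holds the input, and two for each edge that can be stored. -/
abbrev Slot (M : ℕ) : Type := Option (Fin M × Bool)

/-- The questions that can be asked about the registers: whether two registers agree, and what
the color of the vertex in a register is. -/
abbrev Query (M : ℕ) : Type := (Slot M × Slot M) ⊕ Slot M

/-- A record of answers to all questions. -/
abbrev Record (M k : ℕ) : Type := Query M → Bool ⊕ Option (Fin k)

/-- The true answer to a question. -/
def answer {M : ℕ} (χ : Fin n → Fin k) (regs : Slot M → ℕ) : Record M k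
  | .inl (r, s) => .inl (Ord.compare (regs r) (regs s) == .eq)
  | .inr r => .inr (if h : regs r < n then some (χ ⟨regs r, h⟩) else none)

/-- The registers store the list `L`. -/
def Stores {M : ℕ} (regs : Slot M → ℕ) (L : List (Fin n × Fin n)) : Prop :=
  ∀ (a : Fin M × Bool) v, entry L (a.1, a.2) = some v → regs (some a) = v

/-- The record is right about the list `L`. -/
def Consistent {M : ℕ} (rec : Record M k) (χ : Fin n → Fin k) (L : List (Fin n × Fin n)) : Prop :=
  (∀ (a b : Fin M × Bool) v w, entry L (a.1, a.2) = some v → entry L (b.1, b.2) = some w →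
    rec (.inl (some a, some b)) = .inl (decide (v = w))) ∧
  ∀ (a : Fin M × Bool) v, entry L (a.1, a.2) = some v → rec (.inr (some a)) = .inr (some (χ v))

theorem Stores.consistent {M : ℕ} {regs : Slot M → ℕ} {L : List (Fin n × Fin n)}
    (h : Stores regs L) (χ : Fin n → Fin k) : Consistent (answer χ regs) χ L := by
  constructor
  · intro a b v w hv hw
    rw [answer, h a v hv, h b w hw]
    congr 1
    rw [Bool.eq_iff_iff, beq_iff_eq, decide_eq_true_eq, compare_eq_iff_eq, Fin.ext_iff]
  · intro a v hv
    rw [answer, h a v hv]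
    simp

/-- A record that is right about two lists of the same length answers all questions about
coincidences and colors of their entries, so the lists agree up to names. Answers about unused
registers play no role. -/
theorem Consistent.samePattern {M : ℕ} {rec : Record M k} {χ : Fin n → Fin k}
    {χ' : Fin n' → Fin k} {L : List (Fin n × Fin n)} {L' : List (Fin n' × Fin n')}
    (h : Consistent rec χ L) (h' : Consistent rec χ' L') (hl : L.length = L'.length)
    (hM : L.length ≤ M) : SamePattern χ χ' L L' := by
  have hcases : ∀ a : ℕ × Bool, (entry L a = none ∧ entry L' a = none) ∨
      ∃ (a' : Fin M × Bool) (v : Fin n) (v' : Fin n'), a = ((a'.1 : ℕ), a'.2) ∧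
        entry L a = some v ∧ entry L' a = some v' := by
    intro a
    rcases le_or_gt L.length a.1 with ha | ha
    · exact Or.inl ⟨(entry_eq_none_iff _ _).2 ha, (entry_eq_none_iff _ _).2 (hl ▸ ha)⟩
    · obtain ⟨v, hv⟩ := exists_entry_eq ha
      obtain ⟨v', hv'⟩ := exists_entry_eq (hl ▸ ha)
      exact Or.inr ⟨(⟨a.1, by omega⟩, a.2), v, v', rfl, hv, hv'⟩
  constructor
  · intro a b
    rcases hcases a with ⟨ha, ha'⟩ | ⟨a, v, v', rfl, hv, hv'⟩ <;>
    rcases hcases b with ⟨hb, hb'⟩ | ⟨b, w, w', rfl, hw, hw'⟩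
    · simp [ha, ha', hb, hb']
    · simp [ha, ha', hw, hw']
    · simp [hv, hv', hb, hb']
    · have := (h.1 a b v w hv hw).symm.trans (h'.1 a b v' w' hv' hw')
      simpa [hv, hv', hw, hw'] using this
  · intro a
    rcases hcases a with ⟨ha, ha'⟩ | ⟨a, v, v', rfl, hv, hv'⟩
    · simp [ha, ha']
    · have := (h.2 a v hv).symm.trans (h'.2 a v' hv')
      simpa [hv, hv'] using this

open Classical in
/-- The value of an invariant function on the lists of length `j` for which the record is
right. -/
noncomputable def decode {γ : Type u} [Nonempty γ] (M : ℕ)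
    (Φ : ∀ n, (Fin n → Fin k) → List (Fin n × Fin n) → γ) (j : ℕ) (rec : Record M k) : γ :=
  if h : ∃ g, ∃ (n : ℕ) (χ : Fin n → Fin k) (L : List (Fin n × Fin n)),
      L.length = j ∧ Consistent rec χ L ∧ Φ n χ L = g then h.choose
  else Classical.arbitrary γ

/-- `decode` picks a value from an arbitrary instance that fits the record, possibly on another
vertex set. Invariance makes the choice irrelevant. -/
theorem decode_eq {γ : Type u} [Nonempty γ] {M : ℕ}
    {Φ : ∀ n, (Fin n → Fin k) → List (Fin n × Fin n) → γ} (hΦ : PatternInvariant Φ)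
    {rec : Record M k} {χ : Fin n → Fin k} {L : List (Fin n × Fin n)} (hL : L.length ≤ M)
    (h : Consistent rec χ L) : decode M Φ L.length rec = Φ n χ L := by
  have hex : ∃ g, ∃ (n : ℕ) (χ : Fin n → Fin k) (L' : List (Fin n × Fin n)),
      L'.length = L.length ∧ Consistent rec χ L' ∧ Φ n χ L' = g := ⟨_, n, χ, L, rfl, h, rfl⟩
  rw [decode, dif_pos hex]
  obtain ⟨n', χ', L', hl, h', he⟩ := hex.choose_spec
  rw [← he]
  exact hΦ _ _ _ _ _ _ (h'.samePattern h hl (hl.trans_le hL))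

theorem entry_concat_of_lt {L : List (Fin n × Fin n)} {a : ℕ × Bool} (ha : a.1 < L.length)
    (x : Fin n × Fin n) : entry (L ++ [x]) a = entry L a := by
  rw [entry, entry, List.getElem?_append_left ha]

theorem Stores.of_concat {M : ℕ} {regs : Slot M → ℕ} {L : List (Fin n × Fin n)}
    {x : Fin n × Fin n} (h : Stores regs (L ++ [x])) : Stores regs L := by
  intro a v hv
  refine h a v ?_
  rw [entry_concat_of_lt _ x, hv]
  by_contra hlt
  rw [(entry_eq_none_iff _ _).2 (not_lt.1 hlt)] at hv
  simp at hv

theorem Stores.concat {M : ℕ} {regs : Slot M → ℕ} {L : List (Fin n × Fin n)}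
    (h : Stores regs L) (hM : L.length < M) (x : Fin n × Fin n) :
    Stores (Function.update (Function.update regs (some (⟨L.length, hM⟩, false)) x.1)
      (some (⟨L.length, hM⟩, true)) x.2) (L ++ [x]) := by
  rintro ⟨i, b⟩ v hv
  rcases lt_trichotomy i.1 L.length with hi | hi | hi
  · rw [entry_concat_of_lt hi] at hv
    have hne : i ≠ ⟨L.length, hM⟩ := fun h => by simp [h] at hi
    rw [Function.update_of_ne (by simp [hne]), Function.update_of_ne (by simp [hne])]
    exact h _ _ hv
  · obtain rfl : i = ⟨L.length, hM⟩ := Fin.ext hi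
    cases b <;> simp [entry] at hv <;> simp [hv]
  · have : entry (L ++ [x]) (i, b) = none := (entry_eq_none_iff _ _).2 (by simp; omega)
    rw [this] at hv
    simp at hv

variable {Out : Type u} [Nonempty Out]

/-- The questions in some order. -/
noncomputable def queryEquiv (M : ℕ) : Fin (Fintype.card (Query M)) ≃ Query M :=
  (Fintype.equivFin _).symm

/-- The control states: in the first group the algorithm is about to read an edge, in the second
it finds out about the contents of the registers, and in the third it has halted. -/
abbrev Control (M k : ℕ) : Type := (Fin (M + 1) × Record M k) ⊕
  ((Fin M × Fin (Fintype.card (Query M) + 1) × Record M k) ⊕ (Fin (M + 1) × Record M k))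

open Classical in
/-- The program that stores the edges that satisfy a criterion. -/
noncomputable def collectorInstr (M : ℕ)
    (Φ : ∀ n, (Fin n → Fin k) → List (Fin n × Fin n) → Prop)
    (out : ∀ n, (Fin n → Fin k) → List (Fin n × Fin n) → Out) :
    Control M k → StreamInstr (Control M k) (Slot M) k Out
  | .inl (j, rec) =>
    if h : j.1 < M then
      .readEdge (some (⟨j, h⟩, false)) (some (⟨j, h⟩, true)) (.inr (.inl (⟨j, h⟩, 0, rec)))
        (.inr (.inr (j, rec)))
    -- The store is full and the machine loops. With `M` larger than the number of kept edges this
    -- is never reached.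
    else .compare none none fun _ => .inl (j, rec)
  | .inr (.inl (j, p, rec)) =>
    if h : p.1 < Fintype.card (Query M) then
      match queryEquiv M ⟨p, h⟩ with
      | .inl (r, s) => .compare r s fun o => .inr (.inl (j, ⟨p + 1, by omega⟩,
          Function.update rec (.inl (r, s)) (.inl (o == .eq))))
      | .inr r => .queryColor r fun c => .inr (.inl (j, ⟨p + 1, by omega⟩,
          Function.update rec (.inr r) (.inr c)))
    else
      .compare none none fun _ =>
        -- The new edge already sits in slot `j`. Keeping it means advancing the counter; a dropped
        -- edge is overwritten by the next one. `decode` is a fixed finite table independent of `n`,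
        -- so the program is uniform.
        .inl (if decode M Φ (j + 1) rec then j.succ else j.castSucc, rec)
  | .inr (.inr (j, rec)) => .halt (decode M out j rec)

/-- The algorithm that stores the edges that satisfy a criterion. -/
noncomputable abbrev collector (M : ℕ)
    (Φ : ∀ n, (Fin n → Fin k) → List (Fin n × Fin n) → Prop)
    (out : ∀ n, (Fin n → Fin k) → List (Fin n × Fin n) → Out) : StreamAlg k Out where
  Q := Control M k
  R := Slot M
  fintypeQ := Fintype.ofFinite _
  instr := collectorInstr M Φ out
  start := .inl (0, fun _ => .inl false)
  inputReg := none

variable {M : ℕ} {Φ : ∀ n, (Fin n → Fin k) → List (Fin n × Fin n) → Prop}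
  {out : ∀ n, (Fin n → Fin k) → List (Fin n × Fin n) → Out}

theorem collector_step_scan (χ : Fin n → Fin k) (j : Fin M) {p : ℕ}
    (hp : p < Fintype.card (Query M)) (rec : Record M k) (regs : Slot M → ℕ)
    (rest : List (Fin n × Fin n)) :
    (collector M Φ out).step χ ⟨Sum.inr (Sum.inl (j, ⟨p, by omega⟩, rec)), regs, rest⟩ =
      ⟨Sum.inr (Sum.inl (j, ⟨p + 1, by omega⟩, Function.update rec (queryEquiv M ⟨p, hp⟩)
        (answer χ regs (queryEquiv M ⟨p, hp⟩)))), regs, rest⟩ := by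
  rcases hq : queryEquiv M ⟨p, hp⟩ with ⟨r, s⟩ | r <;>
  simp only [StreamAlg.step, collectorInstr, hp, hq, answer, dif_pos]

/-- The sweep asks every question once and overwrites every old answer, so stale entries of `rec` do
no harm. -/
theorem collector_scan (χ : Fin n → Fin k) (j : Fin M) (rec : Record M k) (regs : Slot M → ℕ)
    (rest : List (Fin n × Fin n)) :
    ∃ t, ((collector M Φ out).step χ)^[t] ⟨Sum.inr (Sum.inl (j, 0, rec)), regs, rest⟩ =
      ⟨Sum.inr (Sum.inl (j, Fin.last _, answer χ regs)), regs, rest⟩ := by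
  have key : ∀ (p : ℕ) (hp : p ≤ Fintype.card (Query M)), ∃ rec' : Record M k,
      ((collector M Φ out).step χ)^[p] ⟨Sum.inr (Sum.inl (j, 0, rec)), regs, rest⟩ =
        ⟨Sum.inr (Sum.inl (j, ⟨p, by omega⟩, rec')), regs, rest⟩ ∧
      ∀ i : Fin (Fintype.card (Query M)), i.1 < p →
        rec' (queryEquiv M i) = answer χ regs (queryEquiv M i) := by
    intro p
    induction p with
    | zero => exact fun _ => ⟨rec, rfl, fun i hi => absurd hi (Nat.not_lt_zero _)⟩
    | succ p ih =>
      intro hp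
      obtain ⟨rec', h1, h2⟩ := ih (by omega)
      refine ⟨_, by rw [Function.iterate_succ_apply', h1, collector_step_scan χ j (by omega)], ?_⟩
      intro i hi
      by_cases hip : i = ⟨p, by omega⟩
      · rw [hip, Function.update_self]
      · rw [Function.update_of_ne ((queryEquiv M).injective.ne hip)]
        refine h2 i ?_
        have : i.1 ≠ p := fun h => hip (Fin.ext h)
        omega
  obtain ⟨rec', h1, h2⟩ := key _ le_rfl
  refine ⟨_, h1.trans ?_⟩
  have : rec' = answer χ regs := funext fun q => by
    rw [← (queryEquiv M).apply_symm_apply q]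
    exact h2 _ ((queryEquiv M).symm q).2
  rw [this]
  rfl

/-- Invariant of the main loop: after the prefix `A` has been read, the counter is the number of
kept edges, the registers store them, and the record is right about them. The strict inequality with
`M` leaves a slot free for the next edge to be examined. -/
theorem collector_outputs_aux (hΦ : PatternInvariant Φ) (hout : PatternInvariant out)
    (χ : Fin n → Fin k) (rest : List (Fin n × Fin n)) :
    ∀ (A : List (Fin n × Fin n)),
      (collect (fun B x => Φ n χ (B ++ [x])) (A ++ rest)).length < M →
      ∀ (j : Fin (M + 1)) (rec : Record M k) (regs : Slot M → ℕ),
      j.1 = (collect (fun B x => Φ n χ (B ++ [x])) A).length →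
      Stores regs (collect (fun B x => Φ n χ (B ++ [x])) A) →
      Consistent rec χ (collect (fun B x => Φ n χ (B ++ [x])) A) →
      ∃ t, (collector M Φ out).instr (((collector M Φ out).step χ)^[t]
        ⟨Sum.inl (j, rec), regs, rest⟩).state =
          .halt (out n χ (collect (fun B x => Φ n χ (B ++ [x])) (A ++ rest))) := by
  classical
  induction rest with
  | nil =>
    intro A hlen j rec regs hj hs hc
    rw [List.append_nil] at hlen ⊢
    refine ⟨1, ?_⟩
    have hjM : j.1 < M := hj ▸ hlen
    simp only [Function.iterate_one, StreamAlg.step, collectorInstr, hjM, dif_pos]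
    rw [hj, decode_eq hout hlen.le hc]
  | cons x rest ih =>
    intro A hlen j rec regs hj hs hc
    rw [show A ++ x :: rest = A ++ [x] ++ rest by simp] at hlen ⊢
    set keep := fun B x => Φ n χ (B ++ [x]) with hkeep
    have hmono : ∀ B B' : List (Fin n × Fin n),
        (collect keep B).length ≤ (collect keep (B ++ B')).length := by
      intro B B'
      induction B' using List.reverseRecOn with
      | nil => simp
      | append_singleton B' y ihB =>
        rw [← List.append_assoc, collect_concat]
        split_ifs
        · simp; omega
        · exact ihB
    have hAM : (collect keep A).length < M := by
      have := hmono A ([x] ++ rest)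
      rw [← List.append_assoc] at this
      omega
    set L := collect keep A with hL
    obtain ⟨j, hjlt⟩ := j
    simp only at hj
    subst hj
    have hs' := hs.concat hAM x
    set regs' := Function.update (Function.update regs (some (⟨L.length, hAM⟩, false)) (x.1 : ℕ))
      (some (⟨L.length, hAM⟩, true)) (x.2 : ℕ) with hregs
    have hread : (collector M Φ out).step χ
        ⟨Sum.inl (⟨L.length, hjlt⟩, rec), regs, x :: rest⟩ =
        ⟨Sum.inr (Sum.inl (⟨L.length, hAM⟩, 0, rec)), regs', rest⟩ := by
      simp only [StreamAlg.step, collectorInstr, hAM, dif_pos]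
      rfl
    obtain ⟨t1, ht1⟩ := collector_scan (Φ := Φ) (out := out) χ ⟨L.length, hAM⟩ rec regs' rest
    have hd : decode M Φ (L.length + 1) (answer χ regs') = Φ n χ (L ++ [x]) := by
      have := decode_eq hΦ (L := L ++ [x]) (by simpa using hAM) (hs'.consistent χ)
      rwa [List.length_append, List.length_singleton] at this
    have hback : (collector M Φ out).step χ
        ⟨Sum.inr (Sum.inl (⟨L.length, hAM⟩, Fin.last _, answer χ regs')), regs', rest⟩ =
        ⟨Sum.inl (if Φ n χ (L ++ [x]) then (⟨L.length, hAM⟩ : Fin M).succ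
          else (⟨L.length, hAM⟩ : Fin M).castSucc, answer χ regs'), regs', rest⟩ := by
      simp only [StreamAlg.step, collectorInstr, Fin.val_last, lt_irrefl, dif_neg,
        not_false_eq_true]
      simp only [hd]
    have hcol : collect keep (A ++ [x]) = if Φ n χ (L ++ [x]) then L ++ [x] else L :=
      collect_concat keep A x
    obtain ⟨t2, ht2⟩ := ih (A ++ [x]) hlen (if Φ n χ (L ++ [x]) then (⟨L.length, hAM⟩ : Fin M).succ
        else (⟨L.length, hAM⟩ : Fin M).castSucc) (answer χ regs') regs'
      (by rw [hcol]; split_ifs <;> simp)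
      (by rw [hcol]; split_ifs; exacts [hs', hs'.of_concat])
      (by rw [hcol]; split_ifs; exacts [hs'.consistent χ, hs'.of_concat.consistent χ])
    refine ⟨t2 + (1 + (t1 + 1)), ?_⟩
    rw [Function.iterate_add_apply, Function.iterate_add_apply _ 1,
      Function.iterate_add_apply _ t1, Function.iterate_one, hread, ht1, hback]
    exact ht2

theorem collector_outputs (hΦ : PatternInvariant Φ) (hout : PatternInvariant out)
    (χ : Fin n → Fin k) (stream : List (Fin n × Fin n))
    (hlen : (collect (fun B x => Φ n χ (B ++ [x])) stream).length < M) :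
    (collector M Φ out).Outputs χ stream
      (out n χ (collect (fun B x => Φ n χ (B ++ [x])) stream)) := by
  refine collector_outputs_aux hΦ hout χ stream [] hlen 0 _ _ rfl ?_ ?_
  · intro a v hv
    simp [entry, collect] at hv
  · constructor
    · intro a b v w hv
      simp [entry, collect] at hv
    · intro a v hv
      simp [entry, collect] at hv

/-- The program has no arithmetic; the only new register contents are vertices read from the stream.
-/
theorem collector_step_regs_le (χ : Fin n → Fin k) (c : (collector M Φ out).Config n)
    (hc : ∀ r, c.regs r ≤ n) (r : Slot M) : ((collector M Φ out).step χ c).regs r ≤ n := by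
  obtain ⟨q, regs, rest⟩ := c
  rcases q with ⟨j, rec⟩ | ⟨j, ⟨p, hp⟩, rec⟩ | ⟨j, rec⟩
  · by_cases hj : j.1 < M
    · simp only [StreamAlg.step, collectorInstr, hj, dif_pos]
      cases rest with
      | nil => exact hc r
      | cons e rest =>
        simp only [Function.update_apply]
        split_ifs
        · exact e.2.2.le
        · exact e.1.2.le
        · exact hc r
    · simp only [StreamAlg.step, collectorInstr, hj, dif_neg, not_false_eq_true]
      exact hc r
  · by_cases h : p < Fintype.card (Query M)
    · rw [collector_step_scan χ j h]
      exact hc r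
    · simp only [StreamAlg.step, collectorInstr, h, dif_neg, not_false_eq_true]
      exact hc r
  · exact hc r

theorem size_le_mul_log {n : ℕ} (hn : 2 ≤ n) :
    (Nat.size n : ℝ) ≤ 2 / Real.log 2 * Real.log n := by
  have hlog : 0 < Real.log 2 := Real.log_pos (by norm_num)
  have h2 : 2 ≤ Nat.size n := Nat.lt_size.2 (by simpa using hn)
  obtain ⟨m, hm⟩ : ∃ m, Nat.size n = m + 1 := ⟨Nat.size n - 1, by omega⟩
  have h1 : 2 ^ m ≤ n := Nat.lt_size.1 (by omega)
  have h3 : (m : ℝ) * Real.log 2 ≤ Real.log n := by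
    rw [← Real.log_pow]
    exact Real.log_le_log (by positivity) (by exact_mod_cast h1)
  -- The factor 2 absorbs the extra bit: m + 1 ≤ 2m.
  have h4 : (1 : ℝ) ≤ m := by exact_mod_cast (by omega : 1 ≤ m)
  rw [hm, div_mul_eq_mul_div, le_div_iff₀ hlog]
  push_cast
  nlinarith

variable (M Φ out) in
theorem collector_space : ∃ C : ℝ, 0 < C ∧ ∀ n : ℕ, 2 ≤ n →
    (collector M Φ out).UsesSpaceAtMost n (C * Real.log n) := by
  have hlog : 0 < Real.log 2 := Real.log_pos (by norm_num)
  set a := Nat.clog 2 (@Fintype.card _ (collector M Φ out).fintypeQ) with ha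
  -- The first term pays for the control state, since log 2 ≤ log n, the second for the registers;
  -- the 1 only ensures positivity.
  refine ⟨a / Real.log 2 + Fintype.card (Slot M) * (2 / Real.log 2) + 1, by positivity, ?_⟩
  intro n hn χ stream t
  have hreg : ∀ t r, ((collector M Φ out).run χ stream t).regs r ≤ n := by
    intro t
    induction t with
    | zero =>
      intro r
      simp only [StreamAlg.run, Function.iterate_zero, id, StreamAlg.init, Function.update_apply]
      split_ifs
      · exact le_rfl
      · exact Nat.zero_le n
    | succ t ih =>
      intro r
      rw [StreamAlg.run, Function.iterate_succ_apply']
      exact collector_step_regs_le χ _ ih r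
  have hbits : ((collector M Φ out).run χ stream t).bits ≤
      a + Fintype.card (Slot M) * Nat.size n := by
    refine Nat.add_le_add_left ?_ a
    calc ∑ r, Nat.size (((collector M Φ out).run χ stream t).regs r)
        ≤ ∑ _r : (collector M Φ out).R, Nat.size n :=
          Finset.sum_le_sum fun r _ => Nat.size_le_size (hreg t r)
      _ = Fintype.card (Slot M) * Nat.size n := by
          rw [Finset.sum_const, Finset.card_univ, smul_eq_mul]
  have hln : Real.log 2 ≤ Real.log n := Real.log_le_log (by norm_num) (by exact_mod_cast hn)
  calc (((collector M Φ out).run χ stream t).bits : ℝ)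
      ≤ a + Fintype.card (Slot M) * (Nat.size n : ℝ) := by exact_mod_cast hbits
    _ ≤ a / Real.log 2 * Real.log n +
        Fintype.card (Slot M) * (2 / Real.log 2 * Real.log n) := by
        refine add_le_add ?_ (mul_le_mul_of_nonneg_left (size_le_mul_log hn) (by positivity))
        rw [div_mul_eq_mul_div, le_div_iff₀ hlog]
        exact mul_le_mul_of_nonneg_left hln (by positivity)
    _ ≤ _ := by
        have : 0 ≤ Real.log n := hlog.le.trans hln
        nlinarith

end Machine

end StreamSampling

/-! ### Bounded degree: finitely many types, small balls, and orderings as permutations -/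

namespace DiMultigraph

variable {V : Type} [Fintype V] {k : ℕ}

section Degree

open Classical in
theorem card_neighbors_le (G : DiMultigraph V) {D : ℕ} (hD : G.IsBounded D) (v : V) :
    (Finset.univ.filter fun w => G.toSimple.Adj v w).card ≤ D := by
  refine le_trans ?_ (hD v)
  rw [Finset.card_eq_sum_ones, Finset.sum_filter, degree]
  refine Finset.sum_le_sum fun w _ => ?_
  split_ifs with h
  · rcases h with h | h <;> omega
  · exact Nat.zero_le _

/-- The size of a ball in a graph of bounded degree. -/
theorem ncard_edgeBall_le (G : DiMultigraph V) {D : ℕ} (hD : G.IsBounded D) (ℓ : ℕ) (e : V × V) :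
    (G.edgeBall ℓ e).ncard ≤ 2 * (D + 1) ^ ℓ := by
  classical
  induction ℓ with
  | zero =>
    rw [edgeBall_zero]
    simpa using Set.ncard_insert_le e.1 {e.2}
  | succ ℓ ih =>
    have hsub : (G.edgeBall (ℓ + 1) e).toFinset ⊆ (G.edgeBall ℓ e).toFinset.biUnion fun v =>
        insert v (Finset.univ.filter fun w => G.toSimple.Adj v w) := by
      intro w hw
      rw [Set.mem_toFinset, mem_edgeBall_succ] at hw
      simp only [Finset.mem_biUnion, Set.mem_toFinset, Finset.mem_insert, Finset.mem_filter,
        Finset.mem_univ, true_and]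
      rcases hw with hw | ⟨v, hv, a⟩
      · exact ⟨w, hw, Or.inl rfl⟩
      · exact ⟨v, hv, Or.inr a⟩
    rw [Set.ncard_eq_toFinset_card'] at ih ⊢
    calc _ ≤ _ := Finset.card_le_card hsub
      _ ≤ (G.edgeBall ℓ e).toFinset.card * (D + 1) :=
          Finset.card_biUnion_le_card_mul _ _ _ fun v _ =>
            (Finset.card_insert_le _ _).trans (Nat.succ_le_succ (G.card_neighbors_le hD v))
      _ ≤ 2 * (D + 1) ^ ℓ * (D + 1) := Nat.mul_le_mul_right _ ih
      _ = 2 * (D + 1) ^ (ℓ + 1) := by ring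

end Degree

/-- There are finitely many types. -/
theorem finite_boundedTypes (k ℓ D : ℕ) : Finite (boundedTypes k ℓ D) := by
  classical
  set N := 2 * (D + 1) ^ ℓ
  -- A type is encoded by a representative on an initial segment: its size, multiplicities (at most
  -- `D`), colors and root. The code determines the type.
  have hex : ∀ T : boundedTypes k ℓ D, ∃ d : Σ c : Fin (N + 1),
      (Fin c → Fin c → Fin (D + 1)) × (Fin c → Fin k) × (Fin c × Fin c),
      ∃ X : RootedColoredGraph k, Quotient.mk _ X = T.1 ∧ ∃ φ : X.V ≃ Fin d.1,
        (∀ u v, X.graph.mult u v = d.2.1 (φ u) (φ v)) ∧ (∀ v, X.color v = d.2.2.1 (φ v)) ∧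
        (φ X.root.1, φ X.root.2) = d.2.2.2 := by
    rintro ⟨T, X, hX, hD, hb⟩
    have hcard : Fintype.card X.V ≤ N := by
      rw [← Nat.card_eq_fintype_card, ← Set.ncard_univ, ← Set.eq_univ_of_forall hb]
      exact X.graph.ncard_edgeBall_le hD ℓ X.root
    have hm : ∀ u v, X.graph.mult u v ≤ D := fun u v => by
      refine le_trans ?_ (hD v)
      refine le_trans (Nat.le_add_right _ (X.graph.mult v u)) ?_
      exact Finset.single_le_sum (f := fun u => X.graph.mult u v + X.graph.mult v u)
        (fun _ _ => Nat.zero_le _) (Finset.mem_univ u)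
    set φ := Fintype.equivFin X.V
    exact ⟨⟨⟨Fintype.card X.V, by omega⟩, fun i j => ⟨X.graph.mult (φ.symm i) (φ.symm j),
      Nat.lt_succ_of_le (hm _ _)⟩, fun i => X.color (φ.symm i), (φ X.root.1, φ X.root.2)⟩,
      X, hX, φ, by simp, by simp, rfl⟩
  choose d hd using hex
  refine Finite.of_injective d fun T T' h => ?_
  have hT := hd T
  rw [h] at hT
  obtain ⟨X, hX, φ, h1, h2, h3⟩ := hT
  obtain ⟨X', hX', φ', h1', h2', h3'⟩ := hd T'
  refine Subtype.ext ?_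
  rw [← hX, ← hX']
  refine Quotient.sound (s := RootedColoredGraph.isoSetoid k) ⟨φ.trans φ'.symm, ?_, ?_, ?_⟩
  · intro u v
    simp [h1, h1']
  · intro v
    simp [h2, h2']
  · rw [← h3'] at h3
    have e1 : φ X.root.1 = φ' X'.root.1 := congrArg Prod.fst h3
    have e2 : φ X.root.2 = φ' X'.root.2 := congrArg Prod.snd h3
    simp [e1, e2]

section Orderings

variable [DecidableEq V] {G : DiMultigraph V} {ρ : Fin G.numEdges → V × V}

theorem mem_orderings : ρ ∈ G.orderings ↔ ∀ e : V × V,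
    (Finset.univ.filter fun i => ρ i = e).card = G.mult e.1 e.2 := by
  simp [orderings]

theorem mult_pos_of_mem_orderings (hρ : ρ ∈ G.orderings) (a : Fin G.numEdges) :
    0 < G.mult (ρ a).1 (ρ a).2 := by
  rw [← mem_orderings.1 hρ (ρ a)]
  exact Finset.card_pos.2 ⟨a, by simp⟩

theorem sum_orderings {M : Type} [AddCommMonoid M] (hρ : ρ ∈ G.orderings) (F : V × V → M) :
    ∑ a, F (ρ a) = ∑ e : V × V, G.mult e.1 e.2 • F e := by
  rw [← Finset.sum_fiberwise Finset.univ ρ]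
  refine Finset.sum_congr rfl fun e _ => ?_
  rw [← mem_orderings.1 hρ e, ← Finset.sum_const]
  exact Finset.sum_congr rfl fun a ha => by rw [(Finset.mem_filter.1 ha).2]

theorem comp_perm_mem_orderings (hρ : ρ ∈ G.orderings) (π : Equiv.Perm (Fin G.numEdges)) :
    ρ ∘ π ∈ G.orderings := by
  rw [mem_orderings] at hρ ⊢
  intro e
  rw [← hρ e]
  exact Finset.card_bij (fun i _ => π i) (by simp) (fun _ _ _ _ h => π.injective h)
    fun a ha => ⟨π.symm a, by simpa using ha, by simp⟩

theorem exists_perm_of_mem_orderings (hρ : ρ ∈ G.orderings) {σ : Fin G.numEdges → V × V}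
    (hσ : σ ∈ G.orderings) : ∃ π : Equiv.Perm (Fin G.numEdges), ρ ∘ π = σ := by
  have h : ∀ e, Nonempty ({a // σ a = e} ≃ {a // ρ a = e}) := fun e => by
    refine ⟨Fintype.equivOfCardEq ?_⟩
    rw [Fintype.card_subtype, Fintype.card_subtype, mem_orderings.1 hσ, mem_orderings.1 hρ]
  exact ⟨Equiv.ofFiberEquiv fun e => (h e).some, funext fun a => Equiv.ofFiberEquiv_map _ a⟩

open Classical in
/-- A random ordering is a random permutation of a fixed ordering. -/
theorem orderingProb_eq (hρ : ρ ∈ G.orderings) (P : (Fin G.numEdges → V × V) → Prop) :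
    G.orderingProb P =
      ((Finset.univ.filter fun π : Equiv.Perm (Fin G.numEdges) => P (ρ ∘ π)).card : ℝ) /
        (G.numEdges.factorial : ℝ) := by
  set c := (Finset.univ.filter fun π : Equiv.Perm (Fin G.numEdges) => ρ ∘ π = ρ).card with hc
  -- The permutations carrying `ρ` to `σ` form a coset of the stabilizer of `ρ`, so every ordering
  -- arises equally often.
  have hfib : ∀ σ ∈ G.orderings,
      (Finset.univ.filter fun π : Equiv.Perm (Fin G.numEdges) => ρ ∘ π = σ).card = c := by
    intro σ hσ
    obtain ⟨π₀, rfl⟩ := exists_perm_of_mem_orderings hρ hσ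
    refine Finset.card_bij' (fun π _ => π * π₀⁻¹) (fun π _ => π * π₀) ?_ ?_ ?_ ?_
    · intro π hπ
      simp only [Finset.mem_filter, Finset.mem_univ, true_and] at hπ ⊢
      funext a
      have := congrFun hπ (π₀⁻¹ a)
      simpa using this
    · intro π hπ
      simp only [Finset.mem_filter, Finset.mem_univ, true_and] at hπ ⊢
      funext a
      have := congrFun hπ (π₀ a)
      simpa using this
    · simp
    · simp
  have key : ∀ Q : (Fin G.numEdges → V × V) → Prop,
      (Finset.univ.filter fun π : Equiv.Perm (Fin G.numEdges) => Q (ρ ∘ π)).card =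
        (G.orderings.filter Q).card * c := by
    intro Q
    rw [Finset.card_eq_sum_card_fiberwise (f := fun π : Equiv.Perm (Fin G.numEdges) => ρ ∘ π)
      (t := G.orderings.filter Q), ← smul_eq_mul, ← Finset.sum_const]
    · refine Finset.sum_congr rfl fun σ hσ => ?_
      rw [← hfib σ (Finset.mem_filter.1 hσ).1, Finset.filter_filter]
      congr 1
      refine Finset.filter_congr fun π _ => ?_
      exact ⟨fun h => h.2, fun h => ⟨h ▸ (Finset.mem_filter.1 hσ).2, h⟩⟩
    · intro π hπ
      simp only [Finset.coe_filter, Set.mem_ofPred_eq, Finset.mem_univ, true_and] at hπ ⊢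
      exact ⟨comp_perm_mem_orderings hρ π, hπ⟩
  have hall := key fun _ => True
  simp only [Finset.filter_true, Finset.card_univ, Fintype.card_perm, Fintype.card_fin] at hall
  have hc0 : (c : ℝ) ≠ 0 := by
    have : c ≠ 0 := fun h => by
      rw [h, mul_zero] at hall
      exact (Nat.factorial_pos _).ne' hall
    exact_mod_cast this
  rw [orderingProb, key P, hall]
  push_cast
  rw [mul_div_mul_right _ _ hc0]

/-- The edges that touch the ball around an edge. -/
noncomputable def ballEdges (G : DiMultigraph V) (ρ : Fin G.numEdges → V × V) (ℓ : ℕ)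
    (e : V × V) : Finset (Fin G.numEdges) :=
  open Classical in
  Finset.univ.filter fun b => (ρ b).1 ∈ G.edgeBall ℓ e ∨ (ρ b).2 ∈ G.edgeBall ℓ e

omit [DecidableEq V] in
theorem mem_ballEdges {ℓ : ℕ} {e : V × V} {b : Fin G.numEdges} : b ∈ G.ballEdges ρ ℓ e ↔
    (ρ b).1 ∈ G.edgeBall ℓ e ∨ (ρ b).2 ∈ G.edgeBall ℓ e := by
  simp [ballEdges]

theorem card_ballEdges_le (hρ : ρ ∈ G.orderings) {D : ℕ} (hD : G.IsBounded D) (ℓ : ℕ)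
    (e : V × V) : (G.ballEdges ρ ℓ e).card ≤ 2 * (D + 1) ^ ℓ * D := by
  classical
  have hsub : G.ballEdges ρ ℓ e ⊆ (G.edgeBall ℓ e).toFinset.biUnion fun v =>
      Finset.univ.filter fun b => (ρ b).1 = v ∨ (ρ b).2 = v := by
    intro b hb
    simp only [Finset.mem_biUnion, Set.mem_toFinset, Finset.mem_filter, Finset.mem_univ, true_and]
    rcases mem_ballEdges.1 hb with h | h
    · exact ⟨_, h, Or.inl rfl⟩
    · exact ⟨_, h, Or.inr rfl⟩
  refine (Finset.card_le_card hsub).trans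
    ((Finset.card_biUnion_le_card_mul _ _ D fun v _ => ?_).trans (Nat.mul_le_mul_right D ?_))
  · refine le_trans ?_ (hD v)
    have h1 : (Finset.univ.filter fun b => (ρ b).1 = v).card = ∑ u, G.mult v u := by
      rw [Finset.card_eq_sum_ones, Finset.sum_filter,
        sum_orderings hρ fun e => if e.1 = v then 1 else 0, Fintype.sum_prod_type]
      simp
    have h2 : (Finset.univ.filter fun b => (ρ b).2 = v).card = ∑ u, G.mult u v := by
      rw [Finset.card_eq_sum_ones, Finset.sum_filter,
        sum_orderings hρ fun e => if e.2 = v then 1 else 0, Fintype.sum_prod_type]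
      simp
    rw [Finset.filter_or, degree, Finset.sum_add_distrib, ← h1, ← h2, add_comm]
    exact Finset.card_union_le _ _
  · rw [← Set.ncard_eq_toFinset_card']
    exact G.ncard_edgeBall_le hD ℓ e

/-- An ordering contains all edges of the graph. -/
theorem ofEdges_orderings (hρ : ρ ∈ G.orderings) : ofEdges (Finset.univ.val.map ρ) = G := by
  classical
  have h : ∀ u v, (ofEdges (Finset.univ.val.map ρ)).mult u v = G.mult u v := by
    intro u v
    have h1 := mem_orderings.1 hρ (u, v)
    simp only [ofEdges]
    split_ifs with huv
    · rw [huv, G.loopless]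
    · rw [← h1, Multiset.count_map, Finset.card_def, Finset.filter_val]
      simp only [eq_comm]
  obtain ⟨mult, hl⟩ := G
  simp only [ofEdges, mk.injEq] at h ⊢
  exact funext fun u => funext fun v => h u v

open Classical in
/-- The probability of a type is the fraction of the edges that have it. -/
theorem edgeDist_apply_toReal (hρ : ρ ∈ G.orderings) (χ : V → Fin k) (hχ : G.IsProperColoring χ)
    (ℓ D : ℕ) (hD : G.IsBounded D) (hG : G.numEdges ≠ 0) (T : boundedTypes k ℓ D) :
    (G.edgeDist χ hχ ℓ D hD hG T).toReal =
      (∑ a, if G.HasType χ ℓ (ρ a) T.1 then (1 : ℝ) else 0) / G.numEdges := by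
  have hsum : ∀ F : V × V → ENNReal, (∀ e, G.mult e.1 e.2 = 0 → F e = 0) →
      ∑' e : G.Edge, F e.1 = ∑ e, F e := by
    intro F hF
    refine (tsum_subtype {e : V × V | 0 < G.mult e.1 e.2} F).trans ?_
    rw [tsum_fintype]
    refine Finset.sum_congr rfl fun e _ => ?_
    by_cases he : 0 < G.mult e.1 e.2
    · exact Set.indicator_of_mem (s := {e : V × V | 0 < G.mult e.1 e.2}) he F
    · rw [hF e (by omega)]
      exact Set.indicator_of_notMem (s := {e : V × V | 0 < G.mult e.1 e.2}) he F
  have hnorm : ∑' e : G.Edge, (G.mult e.1.1 e.1.2 : ENNReal) = G.numEdges := by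
    rw [hsum (fun e => (G.mult e.1 e.2 : ENNReal)) fun e he => by simp [he], numEdges]
    push_cast
    rfl
  have h1 : G.edgeDist χ hχ ℓ D hD hG T =
      (∑ a, if G.HasType χ ℓ (ρ a) T.1 then (1 : ENNReal) else 0) * (G.numEdges : ENNReal)⁻¹ := by
    rw [edgeDist, PMF.map_apply, sum_orderings hρ fun e =>
      if G.HasType χ ℓ e T.1 then (1 : ENNReal) else 0, Finset.sum_mul,
      ← hsum (fun e => (G.mult e.1 e.2 • if G.HasType χ ℓ e T.1 then (1 : ENNReal) else 0) *
        (G.numEdges : ENNReal)⁻¹) fun e he => by simp [he]]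
    refine tsum_congr fun e => ?_
    rw [uniformEdge, PMF.normalize_apply, hnorm]
    have := nbrType_eq_iff_hasType G χ hχ ℓ D hD e T
    by_cases h : G.HasType χ ℓ e.1 T.1
    · rw [if_pos (this.2 h).symm, if_pos h, nsmul_eq_mul, mul_one]
    · rw [if_neg fun h' => h (this.1 h'.symm), if_neg h, smul_zero, zero_mul]
  rw [h1, ENNReal.toReal_mul, ENNReal.toReal_inv, ENNReal.toReal_natCast, div_eq_mul_inv,
    ENNReal.toReal_sum fun a _ => by split_ifs <;> simp]
  congr 1
  refine Finset.sum_congr rfl fun a _ => ?_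
  split_ifs <;> simp

end Orderings

end DiMultigraph

/-! ### Independence of vertex names, and the output distribution -/

namespace StreamSampling

open DiMultigraph

variable {k n n' : ℕ}

/-- Lists with the same pattern become equal after renaming the vertices. -/
theorem SamePattern.exists_rename {χ : Fin n → Fin k} {χ' : Fin n' → Fin k}
    {L : List (Fin n × Fin n)} {L' : List (Fin n' × Fin n')} (h : SamePattern χ χ' L L') :
    ∃ ψ : Fin n → Fin n ⊕ Fin n', Function.Injective ψ ∧ (∀ v, Sum.elim χ χ' (ψ v) = χ v) ∧
      L.map (Prod.map ψ ψ) = L'.map (Prod.map Sum.inr Sum.inr) := by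
  classical
  -- A vertex that occurs in `L` goes to its counterpart in `L'`, any other vertex to its own copy
  -- on the left.
  have hex : ∀ v : Fin n, ∃ y : Fin n ⊕ Fin n', (∀ a v', entry L a = some v →
      entry L' a = some v' → y = Sum.inr v') ∧ (y = Sum.inl v ∨ ∃ a v', entry L a = some v ∧
      entry L' a = some v' ∧ y = Sum.inr v') := by
    intro v
    by_cases hv : ∃ a v', entry L a = some v ∧ entry L' a = some v'
    · obtain ⟨a, v', ha, ha'⟩ := hv
      refine ⟨Sum.inr v', fun b w hb hb' => ?_, Or.inr ⟨a, v', ha, ha', rfl⟩⟩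
      have := (h.1 a b).1 (ha.trans hb.symm)
      rw [ha', hb'] at this
      rw [Option.some.inj this]
    · exact ⟨Sum.inl v, fun a v' ha ha' => absurd ⟨a, v', ha, ha'⟩ hv, Or.inl rfl⟩
  choose ψ hψ hψ' using hex
  refine ⟨ψ, ?_, ?_, ?_⟩
  · intro v w hvw
    rcases hψ' v with hv | ⟨a, v', ha, ha', hv⟩ <;> rcases hψ' w with hw | ⟨b, w', hb, hb', hw⟩ <;>
    rw [hv, hw] at hvw
    · exact Sum.inl.inj hvw
    · simp at hvw
    · simp at hvw
    · obtain rfl := Sum.inr.inj hvw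
      have := (h.1 a b).2 (ha'.trans hb'.symm)
      rw [ha, hb] at this
      exact Option.some.inj this
  · intro v
    rcases hψ' v with hv | ⟨a, v', ha, ha', hv⟩
    · rw [hv, Sum.elim_inl]
    · have := h.2 a
      rw [ha, ha', Option.map_some, Option.map_some] at this
      rw [hv, Sum.elim_inr, Option.some.inj this]
  · refine List.ext_getElem? fun i => ?_
    rw [List.getElem?_map, List.getElem?_map]
    have h1 := h.2 (i, false)
    rcases hL : L[i]? with _ | x <;> rcases hL' : L'[i]? with _ | y
    · rfl
    · simp [entry, hL, hL'] at h1
    · simp [entry, hL, hL'] at h1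
    · have e1 := hψ x.1 (i, false) y.1 (by simp [entry, hL]) (by simp [entry, hL'])
      have e2 := hψ x.2 (i, true) y.2 (by simp [entry, hL]) (by simp [entry, hL'])
      rw [Option.map_some, Option.map_some, Prod.map, Prod.map, e1, e2]

/-- Both lists are moved into the disjoint union of the two vertex sets, where they become equal.
The detour is needed because the matching of the occurring vertices need not extend to a
color-preserving injection from `Fin n` to `Fin n'`. -/
theorem patternInvariant_of_map {γ : Type u} (Φ : ∀ V : Type, (V → Fin k) → List (V × V) → γ)
    (hΦ : ∀ (V V' : Type) (ψ : V → V') (χ : V → Fin k) (χ' : V' → Fin k) (L : List (V × V)),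
      Function.Injective ψ → (∀ v, χ' (ψ v) = χ v) → Φ V' χ' (L.map (Prod.map ψ ψ)) = Φ V χ L) :
    PatternInvariant fun n (χ : Fin n → Fin k) L => Φ (Fin n) χ L := by
  intro n n' χ χ' L L' h
  obtain ⟨ψ, hψ, hχ, hL⟩ := h.exists_rename
  have h1 := hΦ _ _ ψ χ (Sum.elim χ χ') L hψ hχ
  rw [hL] at h1
  exact h1.symm.trans (hΦ _ _ Sum.inr χ' _ L' Sum.inr_injective fun v => rfl)

/-- The sum of a function over the first `s` elements of a list, each with the rest of the
list. -/
def rootSum {α : Type} (s : ℕ) (W : α → List α → ℝ) (L : List α) : ℝ :=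
  ∑ i ∈ Finset.range s, (L[i]?).elim 0 fun e => W e (L.eraseIdx i)

theorem rootSum_map {α β : Type} (s : ℕ) (W : α → List α → ℝ) (W' : β → List β → ℝ) (φ : α → β)
    (h : ∀ e L, W' (φ e) (L.map φ) = W e L) (L : List α) :
    rootSum s W' (L.map φ) = rootSum s W L := by
  refine Finset.sum_congr rfl fun i _ => ?_
  rw [List.getElem?_map, List.eraseIdx_map]
  cases L[i]? <;> simp [h]

/-- The estimate of the fraction of the edges of type `T` from the stored edges: exact if these
are all edges. -/
noncomputable def estimate (ℓ s : ℕ) (T : RootedType k) (V : Type) (χ : V → Fin k)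
    (L : List (V × V)) : ℝ :=
  if L.length < s then rootSum L.length (fun e S => typeInd χ ℓ T e S) L / L.length
  else rootSum s (fun e S => totalWeight (Touches ℓ e) (typeInd χ ℓ T e) S) L / s

theorem estimate_map (ℓ s : ℕ) (T : RootedType k) (V V' : Type) (ψ : V → V') (χ : V → Fin k)
    (χ' : V' → Fin k) (L : List (V × V)) (hψ : Function.Injective ψ)
    (hχ : ∀ v, χ' (ψ v) = χ v) :
    estimate ℓ s T V' χ' (L.map (Prod.map ψ ψ)) = estimate ℓ s T V χ L := by
  unfold estimate
  rw [List.length_map, rootSum_map _ (fun e S => typeInd χ ℓ T e S) _ _ fun e L => ?_,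
    rootSum_map _ (fun e S => totalWeight (Touches ℓ e) (typeInd χ ℓ T e) S) _ _ fun e L => ?_]
  · exact totalWeight_map (fun S x => touches_map hψ ℓ e S x)
      (fun S => typeInd_map hψ hχ ℓ T e S) L
  · rw [← Multiset.map_coe]
    exact typeInd_map hψ hχ ℓ T e L

/-- The last edge of a list is to be stored after the others. -/
def lastKept (ℓ s : ℕ) (V : Type) (_χ : V → Fin k) (B : List (V × V)) : Prop :=
  ∃ A x, B = A ++ [x] ∧ keepRule (Touches ℓ) s A x

theorem lastKept_concat (ℓ s : ℕ) (V : Type) (χ : V → Fin k) (A : List (V × V)) (x : V × V) :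
    lastKept ℓ s V χ (A ++ [x]) ↔ keepRule (Touches ℓ) s A x := by
  constructor
  · rintro ⟨A', x', h, hk⟩
    obtain ⟨rfl, hx⟩ := List.append_inj' h rfl
    rwa [List.singleton_inj.1 hx]
  · exact fun h => ⟨A, x, rfl, h⟩

theorem keepRule_map {V V' : Type} {ψ : V → V'} (hψ : Function.Injective ψ) (ℓ s : ℕ)
    (A : List (V × V)) (x : V × V) :
    keepRule (Touches ℓ) s (A.map (Prod.map ψ ψ)) (Prod.map ψ ψ x) ↔
      keepRule (Touches ℓ) s A x := by
  unfold keepRule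
  rw [List.length_map]
  refine or_congr_right (exists_congr fun i => and_congr_right fun _ => ?_)
  rw [List.getElem?_map, List.eraseIdx_map, ← Multiset.map_coe]
  constructor
  · rintro ⟨_, he, ht⟩
    obtain ⟨e, he, rfl⟩ := Option.map_eq_some_iff.1 he
    exact ⟨e, by assumption, (touches_map hψ ℓ e _ x).1 ht⟩
  · rintro ⟨e, he, ht⟩
    exact ⟨_, by rw [he]; rfl, (touches_map hψ ℓ e _ x).2 ht⟩

theorem lastKept_map (ℓ s : ℕ) (V V' : Type) (ψ : V → V') (χ : V → Fin k)
    (χ' : V' → Fin k) (B : List (V × V)) (hψ : Function.Injective ψ) :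
    lastKept ℓ s V' χ' (B.map (Prod.map ψ ψ)) = lastKept ℓ s V χ B := by
  rcases B.eq_nil_or_concat with rfl | ⟨A, x, rfl⟩
  · simp [lastKept]
  · rw [List.concat_eq_append, List.map_append, List.map_singleton, lastKept_concat,
      lastKept_concat, keepRule_map hψ]

open Classical in
/-- A distribution close to a given function, if there is one. -/
noncomputable def nearPMF {S : Type u} [Nonempty S] (η : ℝ) (q : S → ℝ) : PMF S :=
  if h : ∃ p : PMF S, ∀ T, |(p T).toReal - q T| ≤ η then h.choose
  else PMF.pure (Classical.arbitrary S)

/-- The estimates need not form a distribution, so a nearby one is chosen; the true distribution `p`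
shows that one exists. Each point then costs up to 2 * `η`, halved in the total variation distance.
-/
theorem tvDist_nearPMF_le {S : Type u} [Nonempty S] [Finite S] {η : ℝ} {q : S → ℝ} {p : PMF S}
    (hp : ∀ T, |(p T).toReal - q T| ≤ η) : tvDist (nearPMF η q) p ≤ Nat.card S * η := by
  classical
  have hex : ∃ p : PMF S, ∀ T, |(p T).toReal - q T| ≤ η := ⟨p, hp⟩
  have hn : ∀ T, |(nearPMF η q T).toReal - q T| ≤ η := by
    rw [nearPMF, dif_pos hex]
    exact hex.choose_spec
  have := Fintype.ofFinite S
  rw [tvDist, tsum_fintype, Nat.card_eq_fintype_card]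
  have hsum : ∑ T, |(nearPMF η q T).toReal - (p T).toReal| ≤ ∑ _T : S, 2 * η := by
    refine Finset.sum_le_sum fun T _ => ?_
    calc _ ≤ |(nearPMF η q T).toReal - q T| + |q T - (p T).toReal| := abs_sub_le _ _ _
      _ ≤ η + η := add_le_add (hn T) (by rw [abs_sub_comm]; exact hp T)
      _ = 2 * η := by ring
  rw [Finset.sum_const, Finset.card_univ, nsmul_eq_mul] at hsum
  linarith

end StreamSampling

/-! ### The estimator on graphs of bounded degree -/

namespace StreamSampling

open DiMultigraph

variable {k : ℕ} {V : Type} [Fintype V] [DecidableEq V] {G : DiMultigraph V}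
  {ρ : Fin G.numEdges → V × V}

/-- The number of edges that can touch a ball of radius `ℓ` in a graph of maximum degree `D`. -/
abbrev ballSize (ℓ D : ℕ) : ℕ := 2 * (D + 1) ^ ℓ * D

/-- The statistic that indicates the edges of type `T`. -/
noncomputable def typeStatistic {D : ℕ} (hρ : ρ ∈ G.orderings) (hD : G.IsBounded D)
    (χ : V → Fin k) (ℓ : ℕ) (T : RootedType k) : LocalStatistic G.numEdges (V × V) where
  ρ := ρ
  t := Touches ℓ
  f := typeInd χ ℓ T
  isLocal e C S x hS hx := by
    refine typeInd_cons_of_not_touches fun h => hx ?_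
    have := edgeBall_subset_of_not_touches (ℓ := ℓ) (e := e) hS
    exact h.imp (fun h => this h) fun h => this h
  f_nonneg e S := by
    unfold typeInd
    split_ifs <;> simp
  f_le_one e S := by
    unfold typeInd
    split_ifs <;> simp
  loc a := G.ballEdges ρ ℓ (ρ a)
  self_mem_loc a := mem_ballEdges.2 (Or.inl (G.mem_edgeBall_left ℓ _))
  mem_loc a b H h := by
    have hle : (ofEdges (ρ a ::ₘ H.val.map ρ)).toSimple ≤ G.toSimple := by
      intro u v huv
      have hpos : ∀ x ∈ ρ a ::ₘ H.val.map ρ, 0 < G.mult x.1 x.2 := by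
        intro x hx
        rcases Multiset.mem_cons.1 hx with rfl | hx
        · exact mult_pos_of_mem_orderings hρ a
        · obtain ⟨c, -, rfl⟩ := Multiset.mem_map.1 hx
          exact mult_pos_of_mem_orderings hρ c
      exact (ofEdges_adj.1 huv).2.imp (hpos _) (hpos _)
    have := edgeBall_mono hle ℓ (ρ a)
    exact mem_ballEdges.2 (h.imp (fun h => this h) fun h => this h)
  loc_symm a b h := mem_ballEdges.2 (G.touches_edgeBall_symm ℓ (mem_ballEdges.1 h))
  Δ := ballSize ℓ D
  card_loc_le a := card_ballEdges_le hρ hD ℓ _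

open Classical in
theorem typeInd_rest (hρ : ρ ∈ G.orderings) (χ : V → Fin k) (ℓ : ℕ) (T : RootedType k)
    {e : V × V} {S : Multiset (V × V)} (hS : e ::ₘ S = Finset.univ.val.map ρ) :
    typeInd χ ℓ T e S = if G.HasType χ ℓ e T then 1 else 0 := by
  rw [typeInd, hS, ofEdges_orderings hρ]

theorem mean_typeStatistic {D : ℕ} (hρ : ρ ∈ G.orderings) (hD : G.IsBounded D) (χ : V → Fin k)
    (hχ : G.IsProperColoring χ) (ℓ : ℕ) (hG : G.numEdges ≠ 0) (T : boundedTypes k ℓ D) :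
    (typeStatistic hρ hD χ ℓ T.1).mean = (G.edgeDist χ hχ ℓ D hD hG T).toReal := by
  rw [edgeDist_apply_toReal hρ, LocalStatistic.mean]
  congr 1
  refine Finset.sum_congr rfl fun a _ => typeInd_rest hρ χ ℓ T.1 ?_
  refine (Multiset.map_cons ρ a _).symm.trans (congrArg _ ?_)
  rw [Finset.erase_val]
  exact Multiset.cons_erase (Finset.mem_univ a)

theorem estimate_of_lt {D : ℕ} {σ : Fin G.numEdges → V × V} (hσ : σ ∈ G.orderings)
    (hD : G.IsBounded D) (χ : V → Fin k) (hχ : G.IsProperColoring χ) (ℓ : ℕ)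
    (hG : G.numEdges ≠ 0) (T : boundedTypes k ℓ D) {s : ℕ} (hs : G.numEdges < s) :
    estimate ℓ s T.1 V χ (List.ofFn σ) = (G.edgeDist χ hχ ℓ D hD hG T).toReal := by
  rw [edgeDist_apply_toReal hσ, estimate, List.length_ofFn, if_pos hs]
  congr 1
  rw [rootSum, Finset.sum_range]
  refine Finset.sum_congr rfl fun a _ => ?_
  rw [List.getElem?_ofFn, dif_pos a.2]
  refine typeInd_rest hσ χ ℓ T.1 ?_
  rw [Fin.univ_val_map, Multiset.cons_coe, Multiset.coe_eq_coe]
  have := List.getElem_cons_eraseIdx_perm (l := List.ofFn σ) (n := a) (by simp)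
  simpa using this

/-- The roots keep their positions, and the kept edges contain every collectable subsequence at each
root. So the computed quantity is the average of the idealized estimates that use the whole stream.
-/
theorem estimate_collect {D : ℕ} (hρ : ρ ∈ G.orderings) (hD : G.IsBounded D) (χ : V → Fin k)
    (ℓ : ℕ) (T : RootedType k) {s : ℕ} (hs : s ≤ G.numEdges)
    (π : Equiv.Perm (Fin G.numEdges)) :
    estimate ℓ s T V χ (collect (keepRule (Touches ℓ) s) (List.ofFn (ρ ∘ π))) =
      (∑ i : Fin s, (typeStatistic hρ hD χ ℓ T).est (π (Fin.castLE hs i)) π) / s := by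
  have hlen : ¬ (collect (keepRule (Touches ℓ) s) (List.ofFn (ρ ∘ π))).length < s := by
    have := congrArg List.length (take_collect_keepRule (Touches ℓ) s (List.ofFn (ρ ∘ π)))
    rw [List.length_take, List.length_take, List.length_ofFn] at this
    omega
  rw [estimate, if_neg hlen, rootSum, Finset.sum_range]
  congr 1
  refine Finset.sum_congr rfl fun i _ => ?_
  have hi : (List.ofFn (ρ ∘ π))[(i : ℕ)]? = some (ρ (π (Fin.castLE hs i))) := by
    rw [List.getElem?_ofFn, dif_pos (i.2.trans_le hs)]
    rfl
  have hest := (typeStatistic hρ hD χ ℓ T).totalWeight_eq_est π (Fin.castLE hs i)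
  change totalWeight (Touches ℓ (ρ (π (Fin.castLE hs i))))
    (typeInd χ ℓ T (ρ (π (Fin.castLE hs i)))) ((List.ofFn (ρ ∘ π)).eraseIdx i) = _ at hest
  rw [getElem?_collect_keepRule _ i.2, hi, ← hest, Option.elim_some]
  have hcol := sum_sublists_collect (t := Touches ℓ) (fun e S S' x h => Touches.mono h) i.2
    (List.ofFn (ρ ∘ π)) hi
    (w := weight (Touches ℓ (ρ (π (Fin.castLE hs i)))) (typeInd χ ℓ T (ρ (π (Fin.castLE hs i)))))
    fun h hh => weight_of_not_collectable hh
  simpa only [totalWeight] using hcol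

theorem countP_ofFn {α : Type} {m : ℕ} (σ : Fin m → α) (P : α → Prop) [DecidablePred P] :
    (List.ofFn σ).countP P = (Finset.univ.filter fun a => P (σ a)).card := by
  rw [List.ofFn_eq_map, List.countP_map, List.countP_eq_length_filter,
    ← List.toFinset_card_of_nodup ((List.nodup_finRange _).filter _)]
  congr 1
  ext a
  simp

/-- The kept edges span a subgraph of `G`, so an edge kept after the first `s` touches the true ball
of a root; each root accounts for at most `ballSize ℓ D` of these. -/
theorem length_collect_lt {D : ℕ} (hρ : ρ ∈ G.orderings) (hD : G.IsBounded D) (ℓ s : ℕ) :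
    (collect (keepRule (Touches ℓ) s) (List.ofFn ρ)).length < s + s * ballSize ℓ D + 1 := by
  classical
  set P : V × V → Prop := fun x => ∃ i < s, ∃ e, (List.ofFn ρ)[i]? = some e ∧
    (x.1 ∈ G.edgeBall ℓ e ∨ x.2 ∈ G.edgeBall ℓ e) with hP
  have hcount : (List.ofFn ρ).countP P ≤ s * ballSize ℓ D := by
    have h1 : (List.ofFn ρ).countP P = (Finset.univ.filter fun a => P (ρ a)).card := by
      convert countP_ofFn ρ P
    have h2 : (Finset.univ.filter fun a => P (ρ a)) ⊆ (Finset.range s).biUnion fun i =>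
        ((List.ofFn ρ)[i]?).elim ∅ fun e => G.ballEdges ρ ℓ e := by
      intro a ha
      obtain ⟨i, hi, e, he, h⟩ := (Finset.mem_filter.1 ha).2
      refine Finset.mem_biUnion.2 ⟨i, Finset.mem_range.2 hi, ?_⟩
      rw [he]
      exact mem_ballEdges.2 h
    rw [h1]
    refine (Finset.card_le_card h2).trans ((Finset.card_biUnion_le_card_mul _ _ (ballSize ℓ D)
      fun i _ => ?_).trans (by rw [Finset.card_range]))
    cases (List.ofFn ρ)[i]? with
    | none => simp
    | some e => exact card_ballEdges_le hρ hD ℓ e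
  refine Nat.lt_succ_of_le ((length_collect_le _ s P _ fun A x hpre hsA hk => ?_).trans
    (Nat.add_le_add_left hcount s))
  have hpreA : A <+: List.ofFn ρ := (List.prefix_append A [x]).trans hpre
  have hpos : ∀ y ∈ List.ofFn ρ, 0 < G.mult y.1 y.2 := by
    intro y hy
    obtain ⟨a, rfl⟩ := List.mem_ofFn.1 hy
    exact mult_pos_of_mem_orderings hρ a
  have hLsub : ∀ y ∈ collect (keepRule (Touches ℓ) s) A, y ∈ List.ofFn ρ := fun y hy =>
    hpreA.subset ((collect_sublist _ A).subset hy)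
  rcases hk with hk | ⟨i, hi, e, he, ht⟩
  · have := congrArg List.length (take_collect_keepRule (Touches ℓ) s A)
    rw [List.length_take, List.length_take] at this
    omega
  · have heL : e ∈ collect (keepRule (Touches ℓ) s) A := List.mem_of_getElem? he
    have hle : (ofEdges (e ::ₘ ((collect (keepRule (Touches ℓ) s) A).eraseIdx i :
        Multiset (V × V)))).toSimple ≤ G.toSimple := by
      intro u v huv
      have hp : ∀ y ∈ e ::ₘ ((collect (keepRule (Touches ℓ) s) A).eraseIdx i :
          Multiset (V × V)), 0 < G.mult y.1 y.2 := by
        intro y hy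
        rcases Multiset.mem_cons.1 hy with rfl | hy
        · exact hpos _ (hLsub _ heL)
        · exact hpos _ (hLsub _ ((List.eraseIdx_sublist _ _).subset hy))
      exact (ofEdges_adj.1 huv).2.imp (hp _) (hp _)
    have hball := edgeBall_mono hle ℓ e
    rw [getElem?_collect_keepRule _ hi] at he
    refine ⟨i, hi, e, ?_, ht.imp (fun h => hball h) fun h => hball h⟩
    rw [← he]
    obtain ⟨B, hB⟩ := hpreA
    rw [← hB, List.getElem?_append_left (hi.trans_le hsA)]

/-- The constant in the variance of the estimates. -/
noncomputable def varianceConst (ℓ D : ℕ) : ℝ :=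
  (2 ^ ballSize ℓ D * (2 ^ ballSize ℓ D * (ballSize ℓ D).factorial) + 1) ^ 2 +
    2 * (1 + (2 ^ ballSize ℓ D * (2 ^ ballSize ℓ D * (ballSize ℓ D).factorial)) ^ 2 *
      (ballSize ℓ D : ℝ) ^ 2)

open Classical in
/-- Chebyshev's inequality for the estimates. -/
theorem card_bad_le {D : ℕ} (hρ : ρ ∈ G.orderings) (hD : G.IsBounded D) (χ : V → Fin k)
    (ℓ : ℕ) (T : RootedType k) {s : ℕ} (hs2 : 2 ≤ s) (hs : s ≤ G.numEdges) {η : ℝ} (hη : 0 < η) :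
    ((Finset.univ.filter fun π : Equiv.Perm (Fin G.numEdges) => η <
      |(typeStatistic hρ hD χ ℓ T).mean - estimate ℓ s T V χ
        (collect (keepRule (Touches ℓ) s) (List.ofFn (ρ ∘ π)))|).card : ℝ) ≤
      G.numEdges.factorial * (varianceConst ℓ D / (s * η ^ 2)) := by
  set S := typeStatistic hρ hD χ ℓ T with hS
  have hs0 : (0 : ℝ) < s := by exact_mod_cast (by omega : 0 < s)
  have hmom := S.second_moment_le hs2 hs
  set B := Finset.univ.filter fun π : Equiv.Perm (Fin G.numEdges) => η <
      |S.mean - estimate ℓ s T V χ (collect (keepRule (Touches ℓ) s) (List.ofFn (ρ ∘ π)))| with hB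
  have hlow : (B.card : ℝ) * (s * η) ^ 2 ≤
      ∑ π, (∑ i : Fin s, (S.est (π (Fin.castLE hs i)) π - S.mean)) ^ 2 := by
    rw [← nsmul_eq_mul, ← Finset.sum_const]
    refine (Finset.sum_le_sum fun π hπ => ?_).trans (Finset.sum_le_sum_of_subset_of_nonneg
      (Finset.subset_univ B) fun π _ _ => sq_nonneg _)
    have h1 := (Finset.mem_filter.1 hπ).2
    rw [estimate_collect hρ hD χ ℓ T hs π, ← hS] at h1
    have h2 : ∑ i : Fin s, (S.est (π (Fin.castLE hs i)) π - S.mean) =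
        -(s * (S.mean - (∑ i : Fin s, S.est (π (Fin.castLE hs i)) π) / s)) := by
      rw [Finset.sum_sub_distrib, Finset.sum_const, Finset.card_univ, Fintype.card_fin,
        nsmul_eq_mul]
      field_simp
      ring
    rw [h2, neg_sq, ← sq_abs ((s : ℝ) * (S.mean - _)), abs_mul, abs_of_pos hs0]
    exact pow_le_pow_left₀ (by positivity) (mul_le_mul_of_nonneg_left h1.le hs0.le) 2
  have hK : (S.bound + 1) ^ 2 + 2 * (1 + S.bound ^ 2 * (S.Δ : ℝ) ^ 2) = varianceConst ℓ D := rfl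
  rw [hK] at hmom
  have h3 := hlow.trans hmom
  rw [← mul_div_assoc, le_div_iff₀ (by positivity)]
  have h4 : (s : ℝ) * (B.card * (s * η ^ 2)) ≤
      s * (G.numEdges.factorial * varianceConst ℓ D) := by linarith
  exact le_of_mul_le_mul_left h4 hs0

/-- With high probability the estimates of all types are good. -/
theorem one_sub_le_orderingProb (G : DiMultigraph V) {ℓ D : ℕ} (hD : G.IsBounded D)
    (χ : V → Fin k) (hχ : G.IsProperColoring χ) (hG : G.numEdges ≠ 0) {s : ℕ} (hs2 : 2 ≤ s)
    {η δ : ℝ} (hη : 0 < η) (hδ : 0 < δ)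
    (hs : Nat.card (boundedTypes k ℓ D) * (varianceConst ℓ D / (s * η ^ 2)) ≤ δ) :
    1 - δ ≤ G.orderingProb fun σ => ∀ T : boundedTypes k ℓ D,
      |(G.edgeDist χ hχ ℓ D hD hG T).toReal -
        estimate ℓ s T.1 V χ (collect (keepRule (Touches ℓ) s) (List.ofFn σ))| ≤ η := by
  classical
  obtain ⟨ρ, hρ⟩ := G.orderings_nonempty
  have hf : (0 : ℝ) < G.numEdges.factorial := by positivity
  rw [orderingProb_eq hρ, le_div_iff₀ hf]
  -- With fewer than `s` edges everything is stored and the estimate is exact for every order.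
  -- Otherwise Chebyshev's bound is summed over the types.
  rcases lt_or_ge G.numEdges s with hms | hms
  · rw [Finset.filter_true_of_mem, Finset.card_univ, Fintype.card_perm, Fintype.card_fin]
    · nlinarith
    · intro π _ T
      rw [collect_keepRule_of_length_le _ _ _ (by simpa using hms.le),
        estimate_of_lt (comp_perm_mem_orderings hρ π) hD χ hχ ℓ hG T hms, sub_self, abs_zero]
      exact hη.le
  · have := finite_boundedTypes k ℓ D
    have := Fintype.ofFinite (boundedTypes k ℓ D)
    set good := Finset.univ.filter fun π : Equiv.Perm (Fin G.numEdges) =>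
      ∀ T : boundedTypes k ℓ D, |(G.edgeDist χ hχ ℓ D hD hG T).toReal -
        estimate ℓ s T.1 V χ (collect (keepRule (Touches ℓ) s) (List.ofFn (ρ ∘ π)))| ≤ η with hgood
    set bad : boundedTypes k ℓ D → Finset (Equiv.Perm (Fin G.numEdges)) := fun T =>
      Finset.univ.filter fun π => η < |(typeStatistic hρ hD χ ℓ T.1).mean - estimate ℓ s T.1 V χ
        (collect (keepRule (Touches ℓ) s) (List.ofFn (ρ ∘ π)))| with hbad
    have hcover : (Finset.univ : Finset (Equiv.Perm (Fin G.numEdges))) ⊆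
        good ∪ Finset.univ.biUnion bad := by
      intro π _
      by_cases h : π ∈ good
      · exact Finset.mem_union_left _ h
      · refine Finset.mem_union_right _ ?_
        simp only [hgood, Finset.mem_filter, Finset.mem_univ, true_and, not_forall, not_le] at h
        obtain ⟨T, hT⟩ := h
        refine Finset.mem_biUnion.2 ⟨T, Finset.mem_univ _, Finset.mem_filter.2
          ⟨Finset.mem_univ _, ?_⟩⟩
        rwa [mean_typeStatistic hρ hD χ hχ ℓ hG T]
    have h1 : (G.numEdges.factorial : ℝ) ≤ good.card + ∑ T, ((bad T).card : ℝ) := by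
      have := (Finset.card_le_card hcover).trans (Finset.card_union_le _ _)
      have := this.trans (Nat.add_le_add_left Finset.card_biUnion_le _)
      rw [Finset.card_univ, Fintype.card_perm, Fintype.card_fin] at this
      exact_mod_cast this
    have h2 : ∑ T, ((bad T).card : ℝ) ≤ δ * G.numEdges.factorial := by
      calc ∑ T, ((bad T).card : ℝ) ≤ ∑ _T : boundedTypes k ℓ D,
            (G.numEdges.factorial : ℝ) * (varianceConst ℓ D / (s * η ^ 2)) :=
            Finset.sum_le_sum fun T _ => card_bad_le hρ hD χ ℓ T.1 hs2 hms hη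
        _ = (Nat.card (boundedTypes k ℓ D) * (varianceConst ℓ D / (s * η ^ 2))) *
            G.numEdges.factorial := by
            rw [Finset.sum_const, Finset.card_univ, nsmul_eq_mul, Nat.card_eq_fintype_card]
            ring
        _ ≤ _ := mul_le_mul_of_nonneg_right hs hf.le
    have h3 : (1 - δ) * G.numEdges.factorial ≤ good.card := by linarith
    refine h3.trans (le_of_eq ?_)
    rw [hgood]
    congr!

/-- The algorithm that runs forever. -/
def loopForever (k : ℕ) (Out : Type u) : StreamAlg k Out where
  Q := Unit
  R := Unit
  instr _ := .compare () () fun _ => ()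
  start := ()
  inputReg := ()

theorem loopForever_space (k : ℕ) (Out : Type u) : ∃ C : ℝ, 0 < C ∧ ∀ n : ℕ, 2 ≤ n →
    (loopForever k Out).UsesSpaceAtMost n (C * Real.log n) := by
  have hlog : 0 < Real.log 2 := Real.log_pos (by norm_num)
  refine ⟨2 / Real.log 2, by positivity, fun n hn χ stream t => ?_⟩
  have hrun : (loopForever k Out).run χ stream t = (loopForever k Out).init stream :=
    Function.iterate_fixed rfl t
  rw [hrun]
  refine le_trans (le_of_eq ?_) (size_le_mul_log hn)
  have hbits : ((loopForever k Out).init stream).bits = Nat.clog 2 (Fintype.card Unit) +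
      ∑ r : Unit, Nat.size (Function.update (fun _ => 0) () n r) := rfl
  rw [hbits]
  simp

end StreamSampling

/-! ### Choice of the parameters -/

open StreamSampling DiMultigraph in
theorem mainTheorem6 (k ℓ D : ℕ) (ε δ : ℝ) (hε : 0 < ε) (hδ : 0 < δ) :
    ∃ C : ℝ, 0 < C ∧ ∃ A : StreamAlg k (PMF (boundedTypes k ℓ D)),
      (∀ n : ℕ, 2 ≤ n → A.UsesSpaceAtMost n (C * Real.log n)) ∧
      ∀ (n : ℕ) (G : DiMultigraph (Fin n)) (χ : Fin n → Fin k)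
        (hχ : G.IsProperColoring χ) (hD : G.IsBounded D) (hG : G.numEdges ≠ 0),
        (∀ σ ∈ G.orderings, ∃ P, A.Outputs χ (List.ofFn σ) P) ∧
        1 - δ ≤ G.orderingProb fun σ =>
          ∃ P, A.Outputs χ (List.ofFn σ) P ∧ tvDist P (G.edgeDist χ hχ ℓ D hD hG) ≤ ε := by
  classical
  -- Without types there is no distribution to output, but then no admissible graph has an edge and
  -- any machine in small space will do.
  rcases isEmpty_or_nonempty (boundedTypes k ℓ D) with hE | hne
  · obtain ⟨C, hC, hspace⟩ := loopForever_space k (PMF (boundedTypes k ℓ D))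
    refine ⟨C, hC, _, hspace, fun n G χ hχ hD hG => ?_⟩
    obtain ⟨e, -, he⟩ := Finset.exists_ne_zero_of_sum_ne_zero hG
    exact (hE.false (G.nbrType χ hχ ℓ D hD ⟨e, Nat.pos_of_ne_zero he⟩)).elim
  have hfin := finite_boundedTypes k ℓ D
  set N := Nat.card (boundedTypes k ℓ D) with hN
  have hN0 : (0 : ℝ) < N := by exact_mod_cast Nat.card_pos
  set η := ε / N with hη
  have hη0 : 0 < η := by positivity
  obtain ⟨s', hs'⟩ := exists_nat_ge (N * varianceConst ℓ D / (η ^ 2 * δ))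
  -- Large enough for the union bound; adding 2 ensures the hypothesis 2 ≤ s of the second moment
  -- bound.
  set s := s' + 2 with hs
  have hsδ : N * (varianceConst ℓ D / (s * η ^ 2)) ≤ δ := by
    have hs0 : (0 : ℝ) < s := by exact_mod_cast (by omega : 0 < s)
    have h1 : N * varianceConst ℓ D / (η ^ 2 * δ) ≤ s := hs'.trans (by simp [hs])
    rw [div_le_iff₀ (by positivity)] at h1
    rw [← mul_div_assoc, div_le_iff₀ (by positivity)]
    linarith
  set out : ∀ n, (Fin n → Fin k) → List (Fin n × Fin n) → PMF (boundedTypes k ℓ D) :=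
    fun n χ L => nearPMF η fun T => estimate ℓ s T.1 (Fin n) χ L with hout
  set Φ : ∀ n, (Fin n → Fin k) → List (Fin n × Fin n) → Prop :=
    fun n χ B => lastKept ℓ s (Fin n) χ B with hΦ
  have hPMF : Nonempty (PMF (boundedTypes k ℓ D)) := hne.map PMF.pure
  have houtI : PatternInvariant out := patternInvariant_of_map
    (fun V χ L => nearPMF η fun T : boundedTypes k ℓ D => estimate ℓ s T.1 V χ L)
    fun V V' ψ χ χ' L hψ hχ => by simp only [estimate_map ℓ s _ V V' ψ χ χ' L hψ hχ]
  have hΦI : PatternInvariant Φ := patternInvariant_of_map (lastKept ℓ s)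
    fun V V' ψ χ χ' L hψ _ => lastKept_map ℓ s V V' ψ χ χ' L hψ
  -- The roots, the edges near them, and one slot for the edge being examined.
  set M := s + s * ballSize ℓ D + 1 with hM
  obtain ⟨C, hC, hspace⟩ := collector_space M Φ out
  refine ⟨C, hC, _, hspace, fun n G χ hχ hD hG => ?_⟩
  have hkeep : (fun B x => Φ n χ (B ++ [x])) = keepRule (Touches ℓ) s :=
    funext fun B => funext fun x => propext (lastKept_concat ℓ s (Fin n) χ B x)
  have hrun : ∀ σ ∈ G.orderings, (collector M Φ out).Outputs χ (List.ofFn σ)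
      (out n χ (collect (keepRule (Touches ℓ) s) (List.ofFn σ))) := by
    intro σ hσ
    have := collector_outputs (M := M) hΦI houtI χ (List.ofFn σ)
    rw [hkeep] at this
    exact this (length_collect_lt hσ hD ℓ s)
  refine ⟨fun σ hσ => ⟨_, hrun σ hσ⟩, ?_⟩
  refine (one_sub_le_orderingProb G hD χ hχ hG (by omega) hη0 hδ hsδ).trans ?_
  rw [orderingProb, orderingProb]
  refine div_le_div_of_nonneg_right ?_ (Nat.cast_nonneg _)
  refine Nat.cast_le.2 (Finset.card_le_card fun σ hσ => ?_)
  rw [Finset.mem_filter] at hσ ⊢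
  refine ⟨hσ.1, _, hrun σ hσ.1, (tvDist_nearPMF_le hσ.2).trans (le_of_eq ?_)⟩
  rw [← hN, hη]
  field_simp
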